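/- Consider a server with $M<\infty$ files and $L<\infty$ users without caches. File $i$ has size $F_i>0$, the shared link has rate $R>0$, and transmitting file $i$ takes the time $s_i=F_i/R$. User $j$ requests file $i$ at the epochs of a Poisson process of rate $\lambda_{ij}\ge 0$ (no requests if $\lambda_{ij}=0$), where $\lambda_{ij}>0$ for at least one pair $(i,j)$; these processes are independent of each other and of the state at time $0$. The server operates the multicast queue: entries $(i,U)$, with $U$ a set of users, are transmitted one after the other in the order of the queue, without interruption, and the transmission of an entry serves all users in $U$. A request for file $i$ by user $j$ that finds an entry $(i,U)$ waiting (not in transmission) is merged with it, so that $U$ becomes $U\cup\{j\}$; otherwise (in particular if file $i$ is in transmission but not waiting) the new entry $(i,\{j\})$ is appended at the tail, its transmission starting at once if the queue is empty. The state of the system is the list of entries in the queue, including the one in transmission, together with the residual transmission time; the initial distribution is an arbitrary probability law on the possible states (the waiting entries are for distinct files, all user sets are nonempty, and the residual transmission time of a file $i$ in transmission lies in $(0,s_i]$). Let $D_k$ be the queuing delay of the $k$-th request, counted over all files and users ($k=0,1,2,\ldots$), that is, the time from its arrival until the transmission that serves it begins. Then: 1. There are random indices $S_0<S_1<S_2<\cdots$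 such that, for every initial distribution, $\{D_k\}$ is a (possibly delayed) regenerative process with regeneration epochs $\{S_n\}$: for every $n$, the future $\big((S_{n+m}-S_n)_{m\ge0},(D_{S_n+k})_{k\ge 0}\big)$ is independent of the past $\big(S_0,\ldots,S_n,(D_k)_{k<S_n}\big)$, and the law of the future depends neither on $n$ nor on the initial distribution. The regeneration interval has finite mean, $\mathbb E[S_1-S_0]<\infty$, and is aperiodic: the only integer $d\ge 0$ that divides $S_1-S_0$ almost surely is $d=1$. 2. $\{D_k\}$ has a unique stationary distribution: there is exactly one probability measure $\nu$ on $\mathbb R^{\{0,1,2,\ldots\}}$ such that, for some initial distribution, $(D_k,D_{k+1},\ldots)$ has law $\nu$ for all $k$. Moreover, if for some initial distribution all $D_k$ have the same law $\pi$, then $\pi$ is the one-dimensional marginal $\nu_0$ of $\nu$. 3. For every initial distribution, as $k\to\infty$, the law of $D_k$ converges in total variation to $\nu_0$, and the law of $(D_k,D_{k+1},\ldots)$ converges in total variation to $\nu$. -/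

import Mathlib

open MeasureTheory ProbabilityTheory Filter

noncomputable section

namespace MulticastQueue

/-! ### Parameters of the system -/

/-- A server with `M` files and `L` users and no caches: file sizes (bits), the rate of the shared
link (bits per second), and the rate `requestRate i j` at which user `j` requests file `i`. A pair
`(i, j)` of rate `0` produces no requests; some rate is positive, so that there are requests. -/
structure System (M L : ℕ) where
  fileSize : Fin M → ℝ
  fileSize_pos : ∀ i, 0 < fileSize i
  linkRate : ℝ
  linkRate_pos : 0 < linkRate
  requestRate : Fin M → Fin L → ℝ
  requestRate_nonneg : ∀ i j, 0 ≤ requestRate i j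
  exists_requestRate_pos : ∃ i j, 0 < requestRate i j

variable {M L : ℕ}

namespace System

/-- Transmission time of file `i`. -/
def serviceTime (sys : System M L) (i : Fin M) : ℝ := sys.fileSize i / sys.linkRate

/-- The (file, user) pairs that generate requests. -/
abbrev Stream (sys : System M L) : Type :=
  {p : Fin M × Fin L // 0 < sys.requestRate p.1 p.2}

instance (sys : System M L) : Nonempty sys.Stream :=
  let ⟨i, j, h⟩ := sys.exists_requestRate_pos
  ⟨⟨(i, j), h⟩⟩

end System

/-! ### State of the queue and its evolution -/

/-- The queue from head to tail, each entry `(i, U)` being a file together with the set of users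
served by its transmission. The head of a nonempty list is the file being transmitted. -/
abbrev Content (M L : ℕ) : Type := List (Fin M × Finset (Fin L))

/-- The (countable) set of queue contents carries the discrete σ-algebra. -/
instance : MeasurableSpace (Content M L) := ⊤

/-- Queue content together with the residual transmission time of the file at the head
(irrelevant when the queue is empty). -/
abbrev State (M L : ℕ) : Type := Content M L × ℝ

/-- The possible states: an empty queue (residual time `0` by convention), or a file in
transmission with residual time in `(0, s]`, followed by waiting entries for distinct files; user
sets are nonempty. The file in transmission may also be waiting. -/
def ValidState (sys : System M L) : State M L → Prop
  | ([], r) => r = 0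
  | (e :: w, r) => 0 < r ∧ r ≤ sys.serviceTime e.1 ∧ (w.map Prod.fst).Nodup ∧
      ∀ e' ∈ e :: w, e'.2.Nonempty

/-- Evolution during a time `t` without new requests, for a queue with head `e`, waiting entries
`w` and residual time `r`. -/
def serve (sys : System M L) :
    Fin M × Finset (Fin L) → Content M L → ℝ → ℝ → State M L
  | e, [], r, t => if t < r then ([e], r - t) else ([], 0)
  | e, e' :: w, r, t =>
      if t < r then (e :: e' :: w, r - t) else serve sys e' w (sys.serviceTime e'.1) (t - r)

/-- Evolution of a state during a time `t` without new requests. -/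
def advance (sys : System M L) : State M L → ℝ → State M L
  | ([], _), _ => ([], 0)
  | (e :: w, r), t => serve sys e w r t

/-- The state after a request for file `i` by user `j`: into an empty queue it is transmitted at
once; it is merged with a waiting entry for file `i` if there is one; otherwise (in particular if
`i` is being transmitted but is not waiting) it is appended at the tail. -/
def request (sys : System M L) (i : Fin M) (j : Fin L) : State M L → State M L
  | ([], _) => ([(i, {j})], sys.serviceTime i)
  | (e :: w, r) =>
      if i ∈ w.map Prod.fst then
        (e :: w.map (fun e' => if e'.1 = i then (i, insert j e'.2) else e'), r)
      else (e :: (w ++ [(i, {j})]), r)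

/-- Queuing delay of a request for file `i` that finds the given state, i.e. the time until the
transmission that serves it begins: the residual time of the current transmission plus the
transmission times of the entries waiting ahead of the entry which the request joins or creates. -/
def delayIn (sys : System M L) (i : Fin M) : State M L → ℝ
  | ([], _) => 0
  | (_ :: w, r) =>
      r + ((w.takeWhile (fun e' => e'.1 ≠ i)).map
        (fun e' => sys.serviceTime e'.1)).sum

/-! ### Independent Poisson request streams and their superposition -/

/-- Gaps between successive requests: `g (p, n)` is the time from the `n`-th to the `(n+1)`-st
request of stream `p` (from time `0` if `n = 0`). -/
abbrev Gaps (sys : System M L) : Type := sys.Stream × ℕ → ℝ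

/-- Independent Poisson processes: all gaps are independent, and those of stream `(i, j)` are
exponential with rate `requestRate i j`. -/
def gapLaw (sys : System M L) : Measure (Gaps sys) :=
  Measure.infinitePi fun q => expMeasure (sys.requestRate q.1.1.1 q.1.1.2)

/-- A sample point: the state at time `0` and the gaps of all request streams. -/
abbrev Sample (sys : System M L) : Type := State M L × Gaps sys

/-- The law of the sample when the state at time `0` has law `μ` (independent of the requests). -/
def sampleLaw (sys : System M L) (μ : Measure (State M L)) : Measure (Sample sys) :=
  μ.prod (gapLaw sys)

/-- An initial distribution: a probability measure on the possible states. -/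
def IsInitialLaw (sys : System M L) (μ : Measure (State M L)) : Prop :=
  IsProbabilityMeasure μ ∧ ∀ᵐ x ∂μ, ValidState sys x

/-- The time of the `n`-th request (from `n = 0`) of stream `p`. -/
def streamTime (sys : System M L) (g : Gaps sys) (p : sys.Stream) (n : ℕ) : ℝ :=
  ∑ m ∈ Finset.range (n + 1), g (p, m)

open Classical in
/-- The stream at which `f` is smallest (an arbitrary fixed one in case of a tie, an event of
probability zero in what follows). -/
def earliest (sys : System M L) (f : sys.Stream → ℝ) : sys.Stream :=
  if h : ∃ p, ∀ q, q ≠ p → f p < f q then h.choose else Classical.arbitrary _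

/-- How many of the first `k` requests (over all streams) belong to each stream. -/
def counts (sys : System M L) (g : Gaps sys) : ℕ → sys.Stream → ℕ
  | 0 => fun _ => 0
  | k + 1 =>
      let c := counts sys g k
      let p := earliest sys fun q => streamTime sys g q (c q)
      fun q => if q = p then c q + 1 else c q

/-- The stream of the `k`-th request (from `k = 0`) in the superposition of all streams. -/
def arrivalStream (sys : System M L) (g : Gaps sys) (k : ℕ) : sys.Stream :=
  earliest sys fun q => streamTime sys g q (counts sys g k q)

/-- The time of the `k`-th request (from `k = 0`) in the superposition of all streams. -/
def arrivalTime (sys : System M L) (g : Gaps sys) (k : ℕ) : ℝ :=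
  streamTime sys g (arrivalStream sys g k) (counts sys g k (arrivalStream sys g k))

/-! ### The delay process -/

/-- The state found by the `k`-th request (from `k = 0`). -/
def stateFound (sys : System M L) (ω : Sample sys) : ℕ → State M L
  | 0 => advance sys ω.1 (arrivalTime sys ω.2 0)
  | k + 1 =>
      let p := arrivalStream sys ω.2 k
      advance sys (request sys p.1.1 p.1.2 (stateFound sys ω k))
        (arrivalTime sys ω.2 (k + 1) - arrivalTime sys ω.2 k)

/-- The queuing delay of the `k`-th request (from `k = 0`). -/
def delay (sys : System M L) (k : ℕ) (ω : Sample sys) : ℝ :=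
  delayIn sys (arrivalStream sys ω.2 k).1.1 (stateFound sys ω k)

/-- Law of the delay sequence from the `k`-th request on, `(D_k, D_{k+1}, …)`, when the initial
state has law `μ`. -/
def delayLawFrom (sys : System M L) (μ : Measure (State M L)) (k : ℕ) : Measure (ℕ → ℝ) :=
  (sampleLaw sys μ).map fun ω n => delay sys (k + n) ω

/-- `ν` is a stationary distribution of the delay process: for a suitable initial distribution the
delay sequence is strictly stationary with law `ν`. -/
def IsStationaryLaw (sys : System M L) (ν : Measure (ℕ → ℝ)) : Prop :=
  ∃ μ, IsInitialLaw sys μ ∧ ∀ k, delayLawFrom sys μ k = ν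

/-! ### Regenerative processes and total variation -/

/-- `X` is a (possibly delayed) regenerative process with regeneration epochs `S 0 < S 1 < …`:
at each epoch the future (the process and the later epochs, seen from that epoch) is independent
of the past (the process strictly before the epoch, and the epochs so far) and has law `Q`,
whichever the epoch. -/
structure IsRegenerative {Ω : Type*} [MeasurableSpace Ω] (P : Measure Ω) (X : ℕ → Ω → ℝ)
    (S : ℕ → Ω → ℕ) (Q : Measure ((ℕ → ℕ) × (ℕ → ℝ))) : Prop where
  measurable_process : ∀ k, Measurable (X k)
  measurable_epoch : ∀ n, Measurable (S n)
  strictMono : ∀ᵐ ω ∂P, StrictMono fun n => S n ω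
  map_future : ∀ n,
    P.map (fun ω => ((fun m => S (n + m) ω - S n ω), (fun k => X (S n ω + k) ω))) = Q
  indep : ∀ n, IndepFun
    (fun ω => ((fun m => S (min m n) ω : ℕ → ℕ),
      (fun k => if k < S n ω then X k ω else 0 : ℕ → ℝ)))
    (fun ω => ((fun m => S (n + m) ω - S n ω : ℕ → ℕ), (fun k => X (S n ω + k) ω : ℕ → ℝ))) P

/-- The regeneration intervals have finite mean. -/
def HasFiniteMeanCycle {Ω : Type*} [MeasurableSpace Ω] (P : Measure Ω) (S : ℕ → Ω → ℕ) : Prop :=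
  Integrable (fun ω => (S 1 ω : ℝ) - S 0 ω) P

/-- The length of a regeneration interval is not concentrated on `d ℕ` for any `d ≠ 1`. -/
def IsAperiodicCycle {Ω : Type*} [MeasurableSpace Ω] (P : Measure Ω) (S : ℕ → Ω → ℕ) : Prop :=
  ∀ d : ℕ, (∀ᵐ ω ∂P, d ∣ S 1 ω - S 0 ω) → d = 1

/-- Total variation distance of two probability measures. -/
def tvDist {α : Type*} [MeasurableSpace α] (P Q : Measure α) : ℝ :=
  ⨆ A : {A : Set α // MeasurableSet A}, |P.real A - Q.real A|

end MulticastQueue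

end

/-!
The idea is to regenerate at the requests that follow a gap without requests longer than
`workBound`, a bound on the work that can be present in the queue. Such a request finds an empty
queue whatever happened before, and whether it is one depends only on the request streams.

The superposition of the streams is a sequence of independent marks, the mark of a request being its
stream and the time until the next request. These two are independent of each other as well, and the
time is exponential with the total rate. One step of this is `map_first`: seen from the
first request, the gaps have their original law again and are independent of the time and the stream
of that request. It rests on the memorylessness of the exponential law, `expMeasure_memoryless`.
Iterating it gives `map_marks`. Hence the states found by the requests form a Markov chain driven by
independent marks (`stateFound_eq_chain`, `measurePreserving_drive`).

* Regeneration. An epoch is a stopping time for the marks (`epoch_eq_of_agree`), and the marks from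
  an epoch on are independent of those before (`measure_inter_shift`). This gives
  `measure_past_inter_future`: the future of an epoch is a fresh start from an empty queue. The
  cycles are geometric, so that they have finite mean, and have length one with positive probability.
* Stationarity. The occupation of the states during a cycle, normalised, is invariant for the chain
  (`map_step_stationaryLaw`). If a request finds a state of this law, then the state right after that
  request is an initial state for which the delays are stationary.
* Convergence. Two chains with the same marks agree after the first long gap
  (`chain_eq_of_long_gap`), so that the laws of the delays from the `k`-th request on, for any two
  initial laws, differ by at most twice the probability that `k` successive gaps are not long. This
  gives the convergence in total variation, and with it the uniqueness.
-/

open MeasureTheory ProbabilityTheory Filter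

noncomputable section

namespace MulticastQueue

variable {M L : ℕ}

/-! ### Deterministic evolution of the queue -/

lemma System.serviceTime_pos (sys : System M L) (i : Fin M) : 0 < sys.serviceTime i :=
  div_pos (sys.fileSize_pos i) sys.linkRate_pos

/-- A bound on the work in a possible state: the file in transmission and the waiting entries, which
are for distinct files, each need at most the total transmission time of all files. -/
def workBound (sys : System M L) : ℝ := 2 * ∑ i, sys.serviceTime i

lemma workBound_nonneg (sys : System M L) : 0 ≤ workBound sys :=
  mul_nonneg zero_le_two (Finset.sum_nonneg fun i _ => (sys.serviceTime_pos i).le)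

lemma validState_empty (sys : System M L) : ValidState sys ([], 0) := rfl

lemma validState_serve (sys : System M L) (e : Fin M × Finset (Fin L)) (w : Content M L) (r t : ℝ)
    (h : ValidState sys (e :: w, r)) (ht : 0 ≤ t) : ValidState sys (serve sys e w r t) := by
  induction w generalizing e r t with
  | nil =>
    rw [serve]
    split_ifs with h1
    · exact ⟨by linarith, by linarith [h.2.1], h.2.2⟩
    · rfl
  | cons e' w ih =>
    rw [serve]
    split_ifs with h1
    · exact ⟨by linarith, by linarith [h.2.1], h.2.2⟩
    · refine ih e' _ _ ⟨sys.serviceTime_pos _, le_rfl, ?_, ?_⟩ (by linarith)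
      · exact (List.nodup_cons.1 (by simpa using h.2.2.1)).2
      · exact fun x hx => h.2.2.2 x (List.mem_cons_of_mem _ hx)

lemma validState_advance (sys : System M L) {x : State M L} (h : ValidState sys x) {t : ℝ}
    (ht : 0 ≤ t) : ValidState sys (advance sys x t) := by
  rcases x with ⟨_ | ⟨e, w⟩, r⟩
  · rfl
  · exact validState_serve sys e w r t h ht

lemma validState_request (sys : System M L) {x : State M L} (h : ValidState sys x) (i : Fin M)
    (j : Fin L) : ValidState sys (request sys i j x) := by
  rcases x with ⟨_ | ⟨e, w⟩, r⟩
  · exact ⟨sys.serviceTime_pos i, le_rfl, by simp, by simp⟩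
  · rw [request]
    obtain ⟨h1, h2, h3, h4⟩ := h
    split_ifs with hi
    · refine ⟨h1, h2, ?_, ?_⟩
      · have : (w.map fun e' => if e'.1 = i then (i, insert j e'.2) else e').map Prod.fst
            = w.map Prod.fst := by
          rw [List.map_map]
          refine List.map_congr_left fun a _ => ?_
          simp only [Function.comp]
          split_ifs with h
          · exact h.symm
          · rfl
        rwa [this]
      · intro e' he'
        rcases List.mem_cons.1 he' with rfl | he'
        · exact h4 _ List.mem_cons_self
        · obtain ⟨a, ha, rfl⟩ := List.mem_map.1 he'
          split_ifs
          · exact Finset.insert_nonempty _ _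
          · exact h4 _ (List.mem_cons_of_mem _ ha)
    · refine ⟨h1, h2, ?_, ?_⟩
      · rw [List.map_append, List.nodup_append]
        refine ⟨h3, by simp, ?_⟩
        intro a ha b hb hab
        simp only [List.map_cons, List.map_nil, List.mem_singleton] at hb
        exact hi (hb ▸ hab ▸ ha)
      · intro e' he'
        rcases List.mem_cons.1 he' with rfl | he'
        · exact h4 _ List.mem_cons_self
        · rcases List.mem_append.1 he' with he' | he'
          · exact h4 _ (List.mem_cons_of_mem _ he')
          · rw [List.mem_singleton.1 he']
            exact Finset.singleton_nonempty j

lemma serve_eq_empty (sys : System M L) (e : Fin M × Finset (Fin L)) (w : Content M L) (r t : ℝ)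
    (h : r + (w.map fun e' => sys.serviceTime e'.1).sum ≤ t) :
    serve sys e w r t = ([], 0) := by
  induction w generalizing e r t with
  | nil =>
    simp only [List.map_nil, List.sum_nil, add_zero] at h
    rw [serve, if_neg (not_lt.2 h)]
  | cons e' w ih =>
    rw [List.map_cons, List.sum_cons] at h
    have h0 : 0 ≤ (w.map fun e' => sys.serviceTime e'.1).sum :=
      List.sum_nonneg fun x hx => by
        obtain ⟨a, _, rfl⟩ := List.mem_map.1 hx
        exact (sys.serviceTime_pos _).le
    have h1 := sys.serviceTime_pos e'.1
    rw [serve, if_neg (by linarith)]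
    exact ih _ _ _ (by linarith)

/-- A period without requests that is longer than `workBound` empties the queue. -/
lemma advance_eq_empty (sys : System M L) {x : State M L} (h : ValidState sys x) {t : ℝ}
    (ht : workBound sys ≤ t) : advance sys x t = ([], 0) := by
  rcases x with ⟨_ | ⟨e, w⟩, r⟩
  · rfl
  · refine serve_eq_empty sys e w r t (le_trans ?_ ht)
    have h1 : sys.serviceTime e.1 ≤ ∑ i, sys.serviceTime i :=
      Finset.single_le_sum (fun i _ => (sys.serviceTime_pos i).le) (Finset.mem_univ _)
    have h2 : (w.map fun e' => sys.serviceTime e'.1).sum ≤ ∑ i, sys.serviceTime i := by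
      have : (w.map fun e' => sys.serviceTime e'.1) = (w.map Prod.fst).map sys.serviceTime := by
        simp [List.map_map, Function.comp_def]
      rw [this, ← List.sum_toFinset _ h.2.2.1]
      exact Finset.sum_le_univ_sum_of_nonneg fun i => (sys.serviceTime_pos i).le
    have := h.2.1
    rw [workBound]
    linarith

/-! ### Measurability of the evolution -/

instance : MeasurableSingletonClass (Content M L) := ⟨fun _ => trivial⟩

instance : Countable (Content M L) := inferInstanceAs (Countable (List _))

lemma measurable_serve (sys : System M L) (e : Fin M × Finset (Fin L)) (w : Content M L) :
    Measurable fun y : ℝ × ℝ => serve sys e w y.1 y.2 := by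
  induction w generalizing e with
  | nil =>
    simp only [serve]
    exact Measurable.ite (measurableSet_lt measurable_snd measurable_fst)
      (measurable_const.prodMk (measurable_fst.sub measurable_snd)) measurable_const
  | cons e' w ih =>
    simp only [serve]
    refine Measurable.ite (measurableSet_lt measurable_snd measurable_fst)
      (measurable_const.prodMk (measurable_fst.sub measurable_snd)) ?_
    exact (ih e').comp (measurable_const.prodMk (measurable_snd.sub measurable_fst))

/-- A function of a state is measurable if it is so for each queue content. -/
lemma measurable_of_content {α β : Type*} [MeasurableSpace α] [MeasurableSpace β]
    {f : State M L × α → β} (h : ∀ c, Measurable fun y : ℝ × α => f ((c, y.1), y.2)) :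
    Measurable f := by
  have : Measurable fun z : Content M L × (ℝ × α) => f ((z.1, z.2.1), z.2.2) :=
    measurable_from_prod_countable_right h
  exact this.comp (measurable_fst.fst.prodMk (measurable_fst.snd.prodMk measurable_snd))

lemma measurable_advance (sys : System M L) :
    Measurable fun y : State M L × ℝ => advance sys y.1 y.2 := by
  refine measurable_of_content fun c => ?_
  cases c with
  | nil => exact measurable_const
  | cons e w => exact measurable_serve sys e w

lemma measurable_request (sys : System M L) (i : Fin M) (j : Fin L) :
    Measurable (request sys i j) := by
  refine measurable_from_prod_countable_right fun c => ?_
  cases c with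
  | nil => exact measurable_const
  | cons e w =>
    simp only [request]
    split_ifs
    · exact measurable_const.prodMk measurable_id
    · exact measurable_const.prodMk measurable_id

lemma measurable_delayIn (sys : System M L) (i : Fin M) : Measurable (delayIn sys i) := by
  refine measurable_from_prod_countable_right fun c => ?_
  cases c with
  | nil => exact measurable_const
  | cons e w => exact measurable_id.add_const _

lemma measurableSet_validState (sys : System M L) : MeasurableSet {x | ValidState sys x} := by
  have : Measurable (ValidState sys) := by
    refine measurable_from_prod_countable_right fun c => ?_
    cases c with
    | nil => exact measurableSet_setOfPred.1 (measurableSet_eq_fun measurable_id measurable_const)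
    | cons e w =>
      exact measurableSet_setOfPred.1 ((measurableSet_lt measurable_const measurable_id).inter
        ((measurableSet_le measurable_id measurable_const).inter (MeasurableSet.const _)))
  exact measurableSet_setOfPred.2 this

/-! ### The first request of the superposition -/

/-- The stream of the first request. -/
def firstStream (sys : System M L) (g : Gaps sys) : sys.Stream := earliest sys fun q => g (q, 0)

/-- The time of the first request. -/
def firstTime (sys : System M L) (g : Gaps sys) : ℝ := g (firstStream sys g, 0)

/-- The gaps seen from time `w`, if a request of stream `p` occurs at that time and no other
requests have occurred until then. -/
def residual (sys : System M L) (p : sys.Stream) (w : ℝ) (g : Gaps sys) : Gaps sys :=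
  fun q => if q.1 = p then g (p, q.2 + 1) else if q.2 = 0 then g (q.1, 0) - w else g q

/-- The gaps seen from the time of the first request. -/
def afterFirst (sys : System M L) (g : Gaps sys) : Gaps sys :=
  residual sys (firstStream sys g) (firstTime sys g) g

lemma earliest_add_const (sys : System M L) (f : sys.Stream → ℝ) (c : ℝ) :
    earliest sys (fun q => c + f q) = earliest sys f := by
  simp only [earliest, add_lt_add_iff_left]

lemma streamTime_residual_self (sys : System M L) (p : sys.Stream) (g : Gaps sys) (n : ℕ) :
    streamTime sys g p (n + 1) = g (p, 0) + streamTime sys (residual sys p (g (p, 0)) g) p n := by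
  simp only [streamTime, residual, if_true]
  rw [Finset.sum_range_succ', add_comm]

lemma streamTime_residual_of_ne (sys : System M L) {p q : sys.Stream} (h : q ≠ p) (w : ℝ)
    (g : Gaps sys) (n : ℕ) :
    streamTime sys g q n = w + streamTime sys (residual sys p w g) q n := by
  simp only [streamTime, residual, if_neg h]
  rw [Finset.sum_range_succ', Finset.sum_range_succ']
  simp
  ring

lemma counts_succ (sys : System M L) (g : Gaps sys) (k : ℕ) :
    counts sys g (k + 1) = fun q =>
      if q = arrivalStream sys g k then counts sys g k q + 1 else counts sys g k q := rfl

lemma arrivalStream_zero (sys : System M L) (g : Gaps sys) :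
    arrivalStream sys g 0 = firstStream sys g := by
  simp [arrivalStream, firstStream, counts, streamTime]

lemma arrivalTime_zero (sys : System M L) (g : Gaps sys) :
    arrivalTime sys g 0 = firstTime sys g := by
  simp [arrivalTime, firstTime, counts, streamTime, arrivalStream_zero]

/-- Counting from the first request: a stream that has had `c` requests, `c'` of them after the first
request of the superposition, has its next one at the same time in both descriptions. -/
lemma streamTime_of_counts (sys : System M L) (g : Gaps sys) (c c' : sys.Stream → ℕ)
    (h : c = fun q => if q = firstStream sys g then c' q + 1 else c' q) (q : sys.Stream) :
    streamTime sys g q (c q) = firstTime sys g + streamTime sys (afterFirst sys g) q (c' q) := by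
  subst h
  by_cases hq : q = firstStream sys g
  · simp only [hq, if_true]
    exact streamTime_residual_self sys _ g _
  · simp only [hq, if_false]
    exact streamTime_residual_of_ne sys hq _ g _

/-- From its second request on, the superposition is that of the gaps seen from the first request.
This holds for every `g`, ties and negative gaps included, since `earliest` depends only on the
comparison of times. -/
lemma arrivalStream_counts_succ (sys : System M L) (g : Gaps sys) (k : ℕ) :
    arrivalStream sys g (k + 1) = arrivalStream sys (afterFirst sys g) k ∧
    counts sys g (k + 1) = fun q => if q = firstStream sys g
      then counts sys (afterFirst sys g) k q + 1 else counts sys (afterFirst sys g) k q := by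
  induction k with
  | zero =>
    have h : counts sys g 1 = fun q => if q = firstStream sys g
        then counts sys (afterFirst sys g) 0 q + 1 else counts sys (afterFirst sys g) 0 q := by
      rw [counts_succ, arrivalStream_zero]
      rfl
    refine ⟨?_, h⟩
    simp only [arrivalStream, zero_add, streamTime_of_counts sys g _ _ h, earliest_add_const]
  | succ k ih =>
    have h : counts sys g (k + 2) = fun q => if q = firstStream sys g
        then counts sys (afterFirst sys g) (k + 1) q + 1
        else counts sys (afterFirst sys g) (k + 1) q := by
      rw [counts_succ, ih.1, ih.2, counts_succ]
      funext q
      dsimp only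
      split_ifs <;> rfl
    refine ⟨?_, h⟩
    rw [arrivalStream]
    simp only [streamTime_of_counts sys g _ _ h, earliest_add_const]
    rfl

lemma arrivalStream_succ (sys : System M L) (g : Gaps sys) (k : ℕ) :
    arrivalStream sys g (k + 1) = arrivalStream sys (afterFirst sys g) k :=
  (arrivalStream_counts_succ sys g k).1

lemma arrivalTime_succ (sys : System M L) (g : Gaps sys) (k : ℕ) :
    arrivalTime sys g (k + 1) = firstTime sys g + arrivalTime sys (afterFirst sys g) k := by
  rw [arrivalTime, streamTime_of_counts sys g _ _ (arrivalStream_counts_succ sys g k).2,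
    arrivalStream_succ]
  rfl

lemma arrivalStream_eq_iterate (sys : System M L) (g : Gaps sys) (k : ℕ) :
    arrivalStream sys g k = firstStream sys ((afterFirst sys)^[k] g) := by
  induction k generalizing g with
  | zero => exact arrivalStream_zero sys g
  | succ k ih => rw [arrivalStream_succ, ih, Function.iterate_succ_apply]

lemma arrivalTime_sub_eq_iterate (sys : System M L) (g : Gaps sys) (k : ℕ) :
    arrivalTime sys g (k + 1) - arrivalTime sys g k
      = firstTime sys ((afterFirst sys)^[k + 1] g) := by
  induction k generalizing g with
  | zero =>
    rw [arrivalTime_succ, arrivalTime_zero, arrivalTime_zero, add_sub_cancel_left]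
    rfl
  | succ k ih =>
    rw [arrivalTime_succ, arrivalTime_succ sys g k, add_sub_add_left_eq_sub, ih]
    rfl

/-! ### Measurability of the first request -/

lemma earliest_eq (sys : System M L) {f : sys.Stream → ℝ} {p : sys.Stream}
    (h : ∀ q, q ≠ p → f p < f q) : earliest sys f = p := by
  have hex : ∃ p, ∀ q, q ≠ p → f p < f q := ⟨p, h⟩
  rw [earliest, dif_pos hex]
  by_contra hne
  exact lt_asymm (h _ hne) (hex.choose_spec p (Ne.symm hne))

lemma measurable_earliest (sys : System M L) : Measurable (earliest sys) := by
  have hU : ∀ p : sys.Stream,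
      MeasurableSet {f : sys.Stream → ℝ | ∀ q, q ≠ p → f p < f q} := fun p => by
    simp only [Set.ofPred_forall]
    exact MeasurableSet.iInter fun q => MeasurableSet.iInter fun _ =>
      measurableSet_lt (measurable_pi_apply p) (measurable_pi_apply q)
  refine measurable_to_countable' fun p => ?_
  have : earliest sys ⁻¹' {p} = {f | ∀ q, q ≠ p → f p < f q} ∪
      ((⋃ p', {f | ∀ q, q ≠ p' → f p' < f q})ᶜ ∩ {_f | Classical.arbitrary sys.Stream = p}) := by
    ext f
    simp only [Set.mem_preimage, Set.mem_singleton_iff, Set.mem_union, Set.mem_ofPred_eq,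
      Set.mem_inter_iff, Set.mem_compl_iff, Set.mem_iUnion]
    constructor
    · intro h
      by_cases hex : ∃ p, ∀ q, q ≠ p → f p < f q
      · left
        obtain ⟨p', hp'⟩ := hex
        rw [earliest_eq sys hp'] at h
        exact h ▸ hp'
      · rw [earliest, dif_neg hex] at h
        exact Or.inr ⟨hex, h⟩
    · rintro (h | ⟨h1, h2⟩)
      · exact earliest_eq sys h
      · rw [earliest, dif_neg h1, h2]
  rw [this]
  exact (hU p).union ((MeasurableSet.iUnion hU).compl.inter (MeasurableSet.const _))

lemma measurable_firstStream (sys : System M L) : Measurable (firstStream sys) :=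
  (measurable_earliest sys).comp (measurable_pi_lambda _ fun q => measurable_pi_apply (q, 0))

lemma measurable_firstTime (sys : System M L) : Measurable (firstTime sys) := by
  have : Measurable fun z : sys.Stream × Gaps sys => z.2 (z.1, 0) :=
    measurable_from_prod_countable_right fun p => measurable_pi_apply (p, 0)
  exact this.comp ((measurable_firstStream sys).prodMk measurable_id)

lemma measurable_residual (sys : System M L) (p : sys.Stream) :
    Measurable fun z : ℝ × Gaps sys => residual sys p z.1 z.2 := by
  refine measurable_pi_lambda _ fun q => ?_
  simp only [residual]
  split_ifs <;> fun_prop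

lemma measurable_afterFirst (sys : System M L) : Measurable (afterFirst sys) := by
  have h : Measurable fun z : sys.Stream × (ℝ × Gaps sys) => residual sys z.1 z.2.1 z.2.2 := by
    refine measurable_from_prod_countable_right fun p => ?_
    exact measurable_residual sys p
  have h' : Measurable fun g => (firstStream sys g, (firstTime sys g, g)) :=
    (measurable_firstStream sys).prodMk ((measurable_firstTime sys).prodMk measurable_id)
  exact (h.comp h' :)

/-! ### Exponential laws and the law of the first request -/

lemma expMeasure_eq (r : ℝ) : expMeasure r = volume.withDensity (exponentialPDF r) := rfl

lemma measurable_exponentialPDF (r : ℝ) : Measurable (exponentialPDF r) :=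
  (measurable_exponentialPDFReal r).ennreal_ofReal

/-- Memorylessness of the exponential law. -/
lemma expMeasure_memoryless {r w : ℝ} (hw : 0 ≤ w) {B : Set ℝ} (hB : MeasurableSet B) :
    expMeasure r {x | w < x ∧ x - w ∈ B}
      = ENNReal.ofReal (Real.exp (-(r * w))) * expMeasure r B := by
  have hA : MeasurableSet {x | w < x ∧ x - w ∈ B} :=
    (measurableSet_lt measurable_const measurable_id).inter
      ((measurable_id.sub_const w) hB)
  rw [expMeasure_eq, withDensity_apply _ hA, withDensity_apply _ hB, ← lintegral_indicator hA,
    ← lintegral_indicator hB, ← lintegral_const_mul _ ((measurable_exponentialPDF r).indicator hB),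
    ← lintegral_add_right_eq_self _ w]
  refine lintegral_congr_ae ?_
  filter_upwards [Measure.ae_ne volume 0] with y hy
  by_cases hyB : y ∈ B
  · rcases lt_or_gt_of_ne hy with h | h
    · rw [Set.indicator_of_notMem (by simp [h.le]), Set.indicator_of_mem hyB,
        exponentialPDF_of_neg h, mul_zero]
    · rw [Set.indicator_of_mem (by simp [h, hyB]), Set.indicator_of_mem hyB,
        exponentialPDF_of_nonneg h.le, exponentialPDF_of_nonneg (by linarith),
        ← ENNReal.ofReal_mul (Real.exp_nonneg _), mul_left_comm, ← Real.exp_add]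
      ring_nf
  · rw [Set.indicator_of_notMem (by simp [hyB]), Set.indicator_of_notMem hyB, mul_zero]

lemma expMeasure_ae_nonneg (r : ℝ) : ∀ᵐ w ∂expMeasure r, 0 ≤ w := by
  have h : expMeasure r (Set.Iio 0) = 0 := by
    rw [expMeasure_eq, withDensity_apply _ measurableSet_Iio]
    exact lintegral_exponentialPDF_of_nonpos le_rfl
  rw [ae_iff]
  simp only [not_le]
  exact h

lemma expMeasure_Ioi_pos {r : ℝ} (hr : 0 < r) {t : ℝ} (ht : 0 ≤ t) :
    expMeasure r (Set.Ioi t) ≠ 0 := by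
  have : IsProbabilityMeasure (expMeasure r) := isProbabilityMeasure_expMeasure hr
  have h := expMeasure_memoryless (r := r) ht MeasurableSet.univ
  simp only [Set.mem_univ, and_true, measure_univ, mul_one] at h
  rw [show Set.Ioi t = {x | t < x} from rfl, h]
  exact (ENNReal.ofReal_pos.2 (Real.exp_pos _)).ne'

/-- Rate of a request stream. -/
abbrev streamRate (sys : System M L) (p : sys.Stream) : ℝ := sys.requestRate p.1.1 p.1.2

/-- Rate of the superposition of all request streams. -/
def totalRate (sys : System M L) : ℝ := ∑ p : sys.Stream, streamRate sys p

lemma totalRate_pos (sys : System M L) : 0 < totalRate sys :=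
  Finset.sum_pos (fun p _ => p.2) Finset.univ_nonempty

instance (sys : System M L) (p : sys.Stream) :
    IsProbabilityMeasure (expMeasure (sys.requestRate p.1.1 p.1.2)) :=
  isProbabilityMeasure_expMeasure p.2

instance (sys : System M L) : IsProbabilityMeasure (expMeasure (totalRate sys)) :=
  isProbabilityMeasure_expMeasure (totalRate_pos sys)

instance (sys : System M L) : IsProbabilityMeasure (gapLaw sys) := by
  unfold gapLaw; infer_instance

/-- The law of the stream of a request in the superposition. -/
def streamLaw (sys : System M L) : Measure sys.Stream :=
  ∑ p, ENNReal.ofReal (streamRate sys p / totalRate sys) • Measure.dirac p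

instance (sys : System M L) : IsProbabilityMeasure (streamLaw sys) := by
  constructor
  simp only [streamLaw, Measure.coe_finsetSum, Finset.sum_apply, Measure.smul_apply,
    measure_univ, smul_eq_mul, mul_one]
  rw [← ENNReal.ofReal_sum_of_nonneg fun p _ => (div_pos p.2 (totalRate_pos sys)).le,
    ← Finset.sum_div, ← totalRate, div_self (totalRate_pos sys).ne', ENNReal.ofReal_one]

lemma measurable_update_pair {ι : Type*} [DecidableEq ι] {X : ι → Type*}
    [∀ i, MeasurableSpace (X i)] (j : ι) :
    Measurable fun z : X j × (∀ i, X i) => Function.update z.2 j z.1 := by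
  refine measurable_pi_lambda _ fun i => ?_
  by_cases h : i = j
  · subst h; simpa using measurable_fst
  · simp only [Function.update_of_ne h]
    fun_prop

/-- In an infinite product of probability measures, one coordinate may be resampled. -/
lemma map_update_infinitePi {ι : Type*} [DecidableEq ι] {X : ι → Type*}
    [∀ i, MeasurableSpace (X i)] (μ : ∀ i, Measure (X i)) [∀ i, IsProbabilityMeasure (μ i)]
    (j : ι) : ((μ j).prod (Measure.infinitePi μ)).map (fun z => Function.update z.2 j z.1)
      = Measure.infinitePi μ := by
  have hm := measurable_update_pair (X := X) j
  refine Measure.eq_infinitePi _ fun s t ht => ?_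
  rw [Measure.map_apply hm (MeasurableSet.pi s.countable_toSet fun i _ => ht i)]
  have : (fun z : X j × (∀ i, X i) => Function.update z.2 j z.1) ⁻¹' (Set.pi s t)
      = (if j ∈ s then t j else Set.univ) ×ˢ Set.pi (s.erase j : Finset ι) t := by
    ext ⟨w, g⟩
    simp only [Set.mem_preimage, Set.mem_pi, Set.mem_prod, Finset.mem_coe, Finset.mem_erase]
    constructor
    · intro h
      refine ⟨?_, fun i hi => ?_⟩
      · split_ifs with hj
        · simpa using h j hj
        · trivial
      · simpa [Function.update_of_ne hi.1] using h i hi.2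
    · rintro ⟨h1, h2⟩ i hi
      by_cases hij : i = j
      · subst hij
        simpa [hi] using h1
      · simpa [Function.update_of_ne hij] using h2 i ⟨hij, hi⟩
  rw [this, Measure.prod_prod, Measure.infinitePi_pi _ fun i _ => ht i]
  split_ifs with hj
  · exact Finset.mul_prod_erase s (fun i => μ i (t i)) hj
  · rw [measure_univ, one_mul, Finset.erase_eq_of_notMem hj]

/-- The event that no stream other than `p` has a request up to time `w`. -/
def noOtherUntil (sys : System M L) (p : sys.Stream) (w : ℝ) : Set (Gaps sys) :=
  {g | ∀ q, q ≠ p → w < g (q, 0)}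

lemma measurableSet_noOtherUntil (sys : System M L) (p : sys.Stream) :
    MeasurableSet {z : ℝ × Gaps sys | z.2 ∈ noOtherUntil sys p z.1} := by
  change MeasurableSet {z : ℝ × Gaps sys | ∀ q, q ≠ p → z.1 < z.2 (q, 0)}
  simp only [Set.ofPred_forall]
  exact MeasurableSet.iInter fun q => MeasurableSet.iInter fun _ =>
    measurableSet_lt measurable_fst (by fun_prop)

/-- On the event that the streams other than `p` have no request up to time `w`, the gaps seen from
a request of `p` at time `w` have law `gapLaw`, up to the probability of the event. -/
lemma gapLaw_residual (sys : System M L) (p : sys.Stream) {w : ℝ} (hw : 0 ≤ w)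
    {A : Set (Gaps sys)} (hA : MeasurableSet A) :
    gapLaw sys {g | g ∈ noOtherUntil sys p w ∧ residual sys p w g ∈ A}
      = ENNReal.ofReal (Real.exp (-((totalRate sys - streamRate sys p) * w)))
        * gapLaw sys A := by
  classical
  set c := ENNReal.ofReal (Real.exp (-((totalRate sys - streamRate sys p) * w))) with hc
  have hc0 : c ≠ 0 := (ENNReal.ofReal_pos.2 (Real.exp_pos _)).ne'
  have hct : c ≠ ⊤ := ENNReal.ofReal_ne_top
  -- dropping the gap `(p, 0)` and renumbering those of `p` does not change the law
  set σ : sys.Stream × ℕ → sys.Stream × ℕ := fun q => if q.1 = p then (q.1, q.2 + 1) else q with hσ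
  have hσ1 : ∀ q, (σ q).1 = q.1 := fun q => by simp only [hσ]; split_ifs <;> rfl
  have hσinj : Function.Injective σ := by
    rintro ⟨a, n⟩ ⟨b, m⟩ h
    have h1 : a = b := by simpa [hσ1] using congrArg Prod.fst h
    subst h1
    simp only [hσ] at h
    split_ifs at h <;> simp_all
  have hmap : (gapLaw sys).map (fun g i => g (σ i)) = gapLaw sys := by
    rw [gapLaw, Measure.map_infinitePi_infinitePi_of_inj hσinj]
    simp only [hσ1]
  have hmσ : Measurable fun (g : Gaps sys) (i : sys.Stream × ℕ) => g (σ i) := by fun_prop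
  set sub : Gaps sys → Gaps sys := fun g q => if q.1 ≠ p ∧ q.2 = 0 then g q - w else g q with hsub
  have hmsub : Measurable sub := by
    refine measurable_pi_lambda _ fun q => ?_
    simp only [hsub]
    split_ifs <;> fun_prop
  have hN : MeasurableSet (noOtherUntil sys p w) :=
    measurable_prodMk_left (measurableSet_noOtherUntil sys p)
  have hpre : {g | g ∈ noOtherUntil sys p w ∧ residual sys p w g ∈ A}
      = (fun (g : Gaps sys) i => g (σ i)) ⁻¹' (noOtherUntil sys p w ∩ sub ⁻¹' A) := by
    ext g
    have h1 : residual sys p w g = sub fun i => g (σ i) := by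
      funext q
      obtain ⟨q, n⟩ := q
      simp only [residual, hsub, hσ]
      by_cases hq : q = p
      · simp [hq]
      · by_cases hn : n = 0
        · simp [hq, hn]
        · simp [hq, hn]
    have h2 : g ∈ noOtherUntil sys p w ↔ (fun i => g (σ i)) ∈ noOtherUntil sys p w := by
      refine forall_congr' fun q => forall_congr' fun hq => ?_
      simp [hσ, hq]
    rw [Set.mem_ofPred_eq, h1, h2]
    rfl
  rw [hpre, ← Measure.map_apply hmσ (hN.inter (hmsub hA)), hmap]
  -- normalised, the restricted law has the product form on boxes
  have key : c⁻¹ • ((gapLaw sys).restrict (noOtherUntil sys p w)).map sub = gapLaw sys := by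
    refine Measure.eq_infinitePi _ fun s t ht => ?_
    have hbox : MeasurableSet (Set.pi (s : Set (sys.Stream × ℕ)) t) :=
      MeasurableSet.pi s.countable_toSet fun i _ => ht i
    rw [Measure.smul_apply, Measure.map_apply hmsub hbox,
      Measure.restrict_apply (hmsub hbox), smul_eq_mul]
    set s₀ : Finset (sys.Stream × ℕ) := (Finset.univ.erase p).image fun q => (q, 0) with hs₀
    have hmem : ∀ q : sys.Stream × ℕ, q ∈ s₀ ↔ q.1 ≠ p ∧ q.2 = 0 := by
      rintro ⟨q, n⟩
      simp only [hs₀, Finset.mem_image, Finset.mem_erase, Finset.mem_univ, and_true]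
      constructor
      · rintro ⟨a, ha, h⟩
        cases h
        exact ⟨ha, rfl⟩
      · rintro ⟨h1, rfl⟩
        exact ⟨q, h1, rfl⟩
    set t' : sys.Stream × ℕ → Set ℝ := fun q => if q ∈ s then t q else Set.univ with ht'
    have ht'm : ∀ q, MeasurableSet (t' q) := fun q => by
      simp only [ht']
      split_ifs
      · exact ht q
      · exact .univ
    set u : sys.Stream × ℕ → Set ℝ :=
      fun q => if q.1 ≠ p ∧ q.2 = 0 then {x | w < x ∧ x - w ∈ t' q} else t' q with hu
    have hum : ∀ q, MeasurableSet (u q) := fun q => by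
      simp only [hu]
      split_ifs
      · exact (measurableSet_lt measurable_const measurable_id).inter
          ((measurable_id.sub_const w) (ht'm q))
      · exact ht'm q
    have hset : sub ⁻¹' (Set.pi s t) ∩ noOtherUntil sys p w
        = Set.pi ((s ∪ s₀ : Finset _) : Set (sys.Stream × ℕ)) u := by
      ext g
      simp only [Set.mem_inter_iff, Set.mem_preimage, Set.mem_pi, Finset.mem_coe,
        Finset.mem_union, hmem]
      constructor
      · rintro ⟨h1, h2⟩ q hq
        simp only [hu]
        split_ifs with h
        · refine ⟨?_, ?_⟩
          · have := h2 q.1 h.1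
            rwa [← h.2] at this
          · simp only [ht']
            split_ifs with hqs
            · simpa [hsub, h] using h1 q hqs
            · trivial
        · have hqs := hq.resolve_right h
          have := h1 q hqs
          simp only [hsub, if_neg h] at this
          simpa [ht', hqs] using this
      · intro h
        refine ⟨fun q hq => ?_, fun q hq => ?_⟩
        · have := h q (Or.inl hq)
          simp only [hu, ht', hq, if_true] at this
          simp only [hsub]
          split_ifs at this ⊢
          · exact this.2
          · exact this
        · have := h (q, 0) (Or.inr ⟨hq, rfl⟩)
          simp only [hu, ne_eq, hq, not_false_eq_true, and_self, if_true] at this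
          exact this.1
    rw [hset, gapLaw, Measure.infinitePi_pi _ fun i _ => hum i]
    have hfac : ∀ q : sys.Stream × ℕ, expMeasure (sys.requestRate q.1.1.1 q.1.1.2) (u q)
        = (if q ∈ s₀ then ENNReal.ofReal (Real.exp (-(streamRate sys q.1 * w))) else 1)
          * expMeasure (sys.requestRate q.1.1.1 q.1.1.2) (t' q) := fun q => by
      simp only [hu, hmem]
      split_ifs
      · exact expMeasure_memoryless hw (ht'm q)
      · rw [one_mul]
    rw [Finset.prod_congr rfl fun q _ => hfac q, Finset.prod_mul_distrib]
    have h1 : ∏ q ∈ s ∪ s₀,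
        (if q ∈ s₀ then ENNReal.ofReal (Real.exp (-(streamRate sys q.1 * w))) else 1) = c := by
      rw [Finset.prod_ite_mem, Finset.inter_eq_right.2 Finset.subset_union_right, hs₀,
        Finset.prod_image fun a _ b _ h => congrArg Prod.fst h,
        ← ENNReal.ofReal_prod_of_nonneg fun q _ => Real.exp_nonneg _, ← Real.exp_sum, hc,
        Finset.sum_neg_distrib, ← Finset.sum_mul, totalRate,
        ← Finset.add_sum_erase _ _ (Finset.mem_univ p), add_sub_cancel_left]
    have h2 : ∏ q ∈ s ∪ s₀, expMeasure (sys.requestRate q.1.1.1 q.1.1.2) (t' q)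
        = ∏ q ∈ s, expMeasure (sys.requestRate q.1.1.1 q.1.1.2) (t q) := by
      rw [← Finset.prod_subset (Finset.subset_union_left (s₁ := s) (s₂ := s₀))]
      · exact Finset.prod_congr rfl fun q hq => by simp [ht', hq]
      · intro q _ hq
        simp [ht', hq]
    rw [h1, h2, ← mul_assoc, ENNReal.inv_mul_cancel hc0 hct, one_mul]
  conv_rhs => rw [← key]
  rw [Measure.smul_apply, smul_eq_mul, ← mul_assoc, ENNReal.mul_inv_cancel hc0 hct, one_mul,
    Measure.map_apply hmsub hA, Measure.restrict_apply (hmsub hA), Set.inter_comm]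

/-- The time of the first request, its stream and the gaps seen from it are independent, with
exponential law, law `streamLaw` and law `gapLaw`. -/
lemma map_first (sys : System M L) :
    (gapLaw sys).map (fun g => (firstTime sys g, firstStream sys g, afterFirst sys g))
      = (expMeasure (totalRate sys)).prod ((streamLaw sys).prod (gapLaw sys)) := by
  have hΘ : Measurable fun g => (firstTime sys g, firstStream sys g, afterFirst sys g) :=
    (measurable_firstTime sys).prodMk
      ((measurable_firstStream sys).prodMk (measurable_afterFirst sys))
  have : IsProbabilityMeasure ((gapLaw sys).map
      (fun g => (firstTime sys g, firstStream sys g, afterFirst sys g))) :=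
    Measure.isProbabilityMeasure_map hΘ.aemeasurable
  symm
  -- both are probability measures, so that it suffices to compare them from one side
  refine Measure.eq_of_le_of_measure_univ_eq (Measure.le_iff.2 fun A hA => ?_) (by simp)
  have hG : Measurable fun z : ℝ × sys.Stream => gapLaw sys {g | (z.1, z.2, g) ∈ A} := by
    have : Measurable fun y : (ℝ × sys.Stream) × Gaps sys => (y.1.1, y.1.2, y.2) := by fun_prop
    exact measurable_measure_prodMk_left (this hA)
  have hGp : ∀ p, Measurable fun w => gapLaw sys {g | (w, p, g) ∈ A} := fun p =>
    hG.comp (measurable_id.prodMk measurable_const)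
  have hE : ∀ p, MeasurableSet {z : ℝ × Gaps sys |
      z.2 ∈ noOtherUntil sys p z.1 ∧ (z.1, p, residual sys p z.1 z.2) ∈ A} := fun p => by
    refine (measurableSet_noOtherUntil sys p).inter ?_
    have : Measurable fun z : ℝ × Gaps sys => (z.1, p, residual sys p z.1 z.2) :=
      measurable_fst.prodMk (measurable_const.prodMk (measurable_residual sys p))
    exact this hA
  calc (expMeasure (totalRate sys)).prod ((streamLaw sys).prod (gapLaw sys)) A
      = ∫⁻ w, ∑ p, ENNReal.ofReal (streamRate sys p / totalRate sys)
          * gapLaw sys {g | (w, p, g) ∈ A} ∂expMeasure (totalRate sys) := by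
        rw [Measure.prod_apply hA]
        refine lintegral_congr fun w => ?_
        rw [Measure.prod_apply (measurable_prodMk_left hA), streamLaw,
          lintegral_finsetSum_measure]
        refine Finset.sum_congr rfl fun p _ => ?_
        rw [lintegral_smul_measure, lintegral_dirac, smul_eq_mul]
        rfl
    _ = ∑ p, ∫⁻ w, ENNReal.ofReal (Real.exp (-((totalRate sys - streamRate sys p) * w)))
          * gapLaw sys {g | (w, p, g) ∈ A} ∂expMeasure (streamRate sys p) := by
        rw [lintegral_finsetSum _ fun p _ => (hGp p).const_mul _]
        refine Finset.sum_congr rfl fun p _ => ?_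
        have hexp : Measurable fun w =>
            ENNReal.ofReal (Real.exp (-((totalRate sys - streamRate sys p) * w))) := by fun_prop
        rw [expMeasure_eq, expMeasure_eq,
          lintegral_withDensity_eq_lintegral_mul _ (measurable_exponentialPDF _)
            ((hGp p).const_mul _),
          lintegral_withDensity_eq_lintegral_mul _ (measurable_exponentialPDF _)
            (show Measurable fun w => _ * _ from hexp.mul (hGp p))]
        refine lintegral_congr fun w => ?_
        simp only [Pi.mul_apply]
        rw [← mul_assoc, ← mul_assoc]
        congr 1
        rcases lt_or_ge w 0 with hw | hw
        · rw [exponentialPDF_of_neg hw, exponentialPDF_of_neg hw, zero_mul, zero_mul]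
        · have hΛ := totalRate_pos sys
          have hp : 0 < streamRate sys p := p.2
          rw [exponentialPDF_of_nonneg hw, exponentialPDF_of_nonneg hw,
            ← ENNReal.ofReal_mul (by positivity), ← ENNReal.ofReal_mul (by positivity),
            mul_assoc (streamRate sys p), ← Real.exp_add]
          congr 1
          rw [mul_right_comm, mul_div_cancel₀ _ hΛ.ne']
          ring_nf
    _ = ∑ p, ∫⁻ w, gapLaw sys {g | g ∈ noOtherUntil sys p w ∧ (w, p, residual sys p w g) ∈ A}
          ∂expMeasure (streamRate sys p) := by
        refine Finset.sum_congr rfl fun p _ => lintegral_congr_ae ?_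
        filter_upwards [expMeasure_ae_nonneg (streamRate sys p)] with w hw
        exact (gapLaw_residual sys p hw
          (measurable_prodMk_left (measurable_prodMk_left hA) :
            MeasurableSet {g | (w, p, g) ∈ A})).symm
    _ = ∑ p, gapLaw sys {g | g ∈ noOtherUntil sys p (g (p, 0)) ∧
          (g (p, 0), p, residual sys p (g (p, 0)) g) ∈ A} := by
        refine Finset.sum_congr rfl fun p _ => ?_
        classical
        have hup := map_update_infinitePi
          (fun q : sys.Stream × ℕ => expMeasure (sys.requestRate q.1.1.1 q.1.1.2)) (p, 0)
        have hum : Measurable fun z : ℝ × Gaps sys => Function.update z.2 (p, 0) z.1 :=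
          measurable_update_pair (X := fun _ : sys.Stream × ℕ => ℝ) (p, 0)
        have hm : Measurable fun g : Gaps sys => (g (p, 0), g) :=
          (measurable_pi_apply _).prodMk measurable_id
        have hE' : MeasurableSet {g : Gaps sys | g ∈ noOtherUntil sys p (g (p, 0)) ∧
            (g (p, 0), p, residual sys p (g (p, 0)) g) ∈ A} := hm (hE p)
        rw [← gapLaw] at hup
        conv_rhs => rw [← hup]
        rw [Measure.map_apply hum hE', Measure.prod_apply (hum hE')]
        refine lintegral_congr fun w => ?_
        congr 1
        ext g
        have h1 : residual sys p w (Function.update g (p, 0) w) = residual sys p w g := by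
          funext q
          simp only [residual]
          split_ifs with h1 h2
          · rw [Function.update_of_ne (by simp)]
          · rw [Function.update_of_ne (by simp [h1])]
          · rw [Function.update_of_ne fun h => h1 (by rw [h])]
        have h2 : Function.update g (p, 0) w ∈ noOtherUntil sys p w
            ↔ g ∈ noOtherUntil sys p w := by
          refine forall_congr' fun q => forall_congr' fun hq => ?_
          rw [Function.update_of_ne (by simp [hq])]
        simp only [Set.mem_preimage, Set.mem_ofPred_eq, Function.update_self, h1, h2]
    -- equality up to ties, whose probability need not be computed
    _ ≤ gapLaw sys ((fun g => (firstTime sys g, firstStream sys g, afterFirst sys g)) ⁻¹' A) := by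
        have hm : ∀ p, Measurable fun g : Gaps sys => (g (p, 0), g) := fun p =>
          (measurable_pi_apply _).prodMk measurable_id
        have hfs : ∀ (p : sys.Stream) (g : Gaps sys), g ∈ noOtherUntil sys p (g (p, 0)) →
            firstStream sys g = p := fun p g hg => earliest_eq sys hg
        rw [← tsum_fintype (L := SummationFilter.unconditional _), ← measure_iUnion]
        · refine measure_mono (Set.iUnion_subset fun p g hg => ?_)
          have h1 := hfs p g hg.1
          have h2 := hg.2
          simpa [afterFirst, firstTime, h1] using h2
        · intro p q hpq
          refine Set.disjoint_left.2 fun g hg hg' => hpq ?_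
          rw [← hfs p g hg.1, hfs q g hg'.1]
        · exact fun p => hm p (hE p)
    _ = _ := (Measure.map_apply hΘ hA).symm

/-! ### Sequences of independent identically distributed variables -/

/-- If one step of a dynamical system `θ` splits the law `P` into an independent observation of law
`m` and a new point of law `P`, then the successive observations are independent of law `m`. -/
lemma map_iterate_eq_infinitePi {Ω E : Type*} [MeasurableSpace Ω] [MeasurableSpace E]
    {P : Measure Ω} {m : Measure E} [IsProbabilityMeasure P] [IsProbabilityMeasure m]
    {f : Ω → E} {θ : Ω → Ω} (hf : Measurable f) (hθ : Measurable θ)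
    (h : P.map (fun ω => (f ω, θ ω)) = m.prod P) :
    P.map (fun ω (k : ℕ) => f (θ^[k] ω)) = Measure.infinitePi fun _ => m := by
  have hV : Measurable fun ω (k : ℕ) => f (θ^[k] ω) :=
    measurable_pi_lambda _ fun k => hf.comp (hθ.iterate k)
  have key : ∀ (n : ℕ) (u : ℕ → Set E), (∀ i, MeasurableSet (u i)) →
      P {ω | ∀ i < n, f (θ^[i] ω) ∈ u i} = ∏ i ∈ Finset.range n, m (u i) := by
    intro n
    induction n with
    | zero => intro u _; simp
    | succ n ih =>
      intro u hu
      have hB : MeasurableSet {ω | ∀ i < n, f (θ^[i] ω) ∈ u (i + 1)} := by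
        simp only [Set.ofPred_forall]
        exact MeasurableSet.iInter fun i => MeasurableSet.iInter fun _ =>
          hf.comp (hθ.iterate i) (hu (i + 1))
      have : {ω | ∀ i < n + 1, f (θ^[i] ω) ∈ u i}
          = (fun ω => (f ω, θ ω)) ⁻¹' (u 0 ×ˢ {ω | ∀ i < n, f (θ^[i] ω) ∈ u (i + 1)}) := by
        ext ω
        simp only [Set.mem_ofPred_eq, Set.mem_preimage, Set.mem_prod]
        constructor
        · intro h
          exact ⟨h 0 n.succ_pos, fun i hi => h (i + 1) (Nat.succ_lt_succ hi)⟩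
        · rintro ⟨h0, h1⟩ i hi
          cases i with
          | zero => exact h0
          | succ i => exact h1 i (Nat.succ_lt_succ_iff.1 hi)
      rw [this, ← Measure.map_apply (hf.prodMk hθ) ((hu 0).prod hB), h, Measure.prod_prod,
        ih _ fun i => hu (i + 1), Finset.prod_range_succ', mul_comm]
  refine Measure.eq_infinitePi _ fun s t ht => ?_
  classical
  obtain ⟨n, hn⟩ := s.exists_nat_subset_range
  have hu : ∀ i, MeasurableSet (if i ∈ s then t i else Set.univ) := fun i => by
    split_ifs
    · exact ht i
    · exact .univ
  have hprod : ∏ i ∈ s, m (t i) = ∏ i ∈ Finset.range n, m (if i ∈ s then t i else Set.univ) := by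
    rw [← Finset.prod_subset hn fun i _ hi => by simp [hi]]
    exact Finset.prod_congr rfl fun i hi => by rw [if_pos hi]
  rw [Measure.map_apply hV (MeasurableSet.pi s.countable_toSet fun i _ => ht i), hprod,
    ← key n _ hu]
  congr 1
  ext ω
  simp only [Set.mem_preimage, Set.mem_pi, Finset.mem_coe, Set.mem_ofPred_eq]
  constructor
  · intro h i _
    split_ifs with his
    · exact h i his
    · trivial
  · intro h i his
    simpa [his] using h i (Finset.mem_range.1 (hn his))

/-- The sequence that agrees with `V` before `k` and continues with `V'` from `k` on. -/
def splice {E : Type*} (k : ℕ) (V V' : ℕ → E) : ℕ → E :=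
  fun i => if i < k then V i else V' (i - k)

/-- The sequence `V` seen from `k` on. -/
def shift {E : Type*} (k : ℕ) (V : ℕ → E) : ℕ → E := fun i => V (k + i)

lemma splice_of_lt {E : Type*} {k i : ℕ} (h : i < k) (V V' : ℕ → E) :
    splice k V V' i = V i := if_pos h

@[simp] lemma shift_splice {E : Type*} (k : ℕ) (V V' : ℕ → E) :
    shift k (splice k V V') = V' := by
  funext i
  simp [shift, splice]

lemma measurable_splice {E : Type*} [MeasurableSpace E] (k : ℕ) :
    Measurable fun z : (ℕ → E) × (ℕ → E) => splice k z.1 z.2 := by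
  refine measurable_pi_lambda _ fun i => ?_
  simp only [splice]
  split_ifs <;> fun_prop

lemma measurable_shift {E : Type*} [MeasurableSpace E] (k : ℕ) :
    Measurable (shift k : (ℕ → E) → ℕ → E) :=
  measurable_pi_lambda _ fun i => measurable_pi_apply (k + i)

/-- For independent identically distributed sequences, splicing leaves the law unchanged. -/
lemma map_splice {E : Type*} [MeasurableSpace E] (m : Measure E) [IsProbabilityMeasure m] (k : ℕ) :
    ((Measure.infinitePi fun _ : ℕ => m).prod (Measure.infinitePi fun _ : ℕ => m)).map
      (fun z => splice k z.1 z.2) = Measure.infinitePi fun _ : ℕ => m := by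
  classical
  refine Measure.eq_infinitePi _ fun s t ht => ?_
  rw [Measure.map_apply (measurable_splice k)
    (MeasurableSet.pi s.countable_toSet fun i _ => ht i)]
  have : (fun z : (ℕ → E) × (ℕ → E) => splice k z.1 z.2) ⁻¹' (Set.pi s t)
      = Set.pi (s.filter (· < k) : Finset ℕ) t ×ˢ
        Set.pi ((s.filter (¬ · < k)).image (· - k) : Finset ℕ) (fun i => t (i + k)) := by
    ext ⟨V, V'⟩
    simp only [Set.mem_preimage, Set.mem_pi, Set.mem_prod, Finset.mem_coe, Finset.mem_filter,
      Finset.mem_image, splice]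
    constructor
    · intro h
      refine ⟨fun i hi => by simpa [hi.2] using h i hi.1, ?_⟩
      rintro _ ⟨i, hi, rfl⟩
      rw [Nat.sub_add_cancel (not_lt.1 hi.2)]
      simpa [hi.2] using h i hi.1
    · rintro ⟨h1, h2⟩ i hi
      split_ifs with hik
      · exact h1 i ⟨hi, hik⟩
      · have := h2 (i - k) ⟨i, ⟨hi, hik⟩, rfl⟩
        rwa [Nat.sub_add_cancel (not_lt.1 hik)] at this
  rw [this, Measure.prod_prod, Measure.infinitePi_pi _ fun i _ => ht i,
    Measure.infinitePi_pi _ fun i _ => ht (i + k), Finset.prod_image,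
    ← Finset.prod_filter_mul_prod_filter_not s (· < k)]
  · congr 1
    refine Finset.prod_congr rfl fun i hi => ?_
    rw [Nat.sub_add_cancel (not_lt.1 (Finset.mem_filter.1 hi).2)]
  · intro a ha b hb h
    have h1 := (Finset.mem_filter.1 ha).2
    have h2 := (Finset.mem_filter.1 hb).2
    dsimp only at h
    omega

/-! ### The requests as independent marks -/

/-- The law of a mark: the stream of a request and the time until the next request. -/
def markLaw (sys : System M L) : Measure (sys.Stream × ℝ) :=
  (streamLaw sys).prod (expMeasure (totalRate sys))

instance (sys : System M L) : IsProbabilityMeasure (markLaw sys) := by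
  unfold markLaw; infer_instance

/-- The law of a sequence of independent marks. -/
def marksLaw (sys : System M L) : Measure (ℕ → sys.Stream × ℝ) :=
  Measure.infinitePi fun _ => markLaw sys

instance (sys : System M L) : IsProbabilityMeasure (marksLaw sys) := by
  unfold marksLaw; infer_instance

/-- The mark of the `k`-th request: its stream and the time until the next request. -/
def marks (sys : System M L) (g : Gaps sys) (k : ℕ) : sys.Stream × ℝ :=
  (arrivalStream sys g k, arrivalTime sys g (k + 1) - arrivalTime sys g k)

lemma map_marks (sys : System M L) :
    Measurable (fun g => (arrivalTime sys g 0, marks sys g)) ∧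
    (gapLaw sys).map (fun g => (arrivalTime sys g 0, marks sys g))
      = (expMeasure (totalRate sys)).prod (marksLaw sys) := by
  set f : sys.Stream × Gaps sys → sys.Stream × ℝ := fun z => (z.1, firstTime sys z.2) with hf
  set θ : sys.Stream × Gaps sys → sys.Stream × Gaps sys :=
    fun z => (firstStream sys z.2, afterFirst sys z.2) with hθ
  have hfm : Measurable f := measurable_fst.prodMk ((measurable_firstTime sys).comp measurable_snd)
  have hθm : Measurable θ := ((measurable_firstStream sys).comp measurable_snd).prodMk
    ((measurable_afterFirst sys).comp measurable_snd)
  have hΘ : Measurable fun g => (firstTime sys g, firstStream sys g, afterFirst sys g) :=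
    (measurable_firstTime sys).prodMk
      ((measurable_firstStream sys).prodMk (measurable_afterFirst sys))
  have hstep : ((streamLaw sys).prod (gapLaw sys)).map (fun z => (f z, θ z))
      = (markLaw sys).prod ((streamLaw sys).prod (gapLaw sys)) := by
    have h1 : MeasurePreserving
        (Prod.map id fun g => (firstTime sys g, firstStream sys g, afterFirst sys g))
        ((streamLaw sys).prod (gapLaw sys)) ((streamLaw sys).prod
          ((expMeasure (totalRate sys)).prod ((streamLaw sys).prod (gapLaw sys)))) :=
      (MeasurePreserving.id _).prod ⟨hΘ, map_first sys⟩
    have h2 := (measurePreserving_prodAssoc (streamLaw sys) (expMeasure (totalRate sys))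
      ((streamLaw sys).prod (gapLaw sys))).symm
    exact (h2.comp h1).map_eq
  have hV : Measurable fun z (k : ℕ) => f (θ^[k] z) :=
    measurable_pi_lambda _ fun k => hfm.comp (hθm.iterate k)
  have hmarks : ∀ g, marks sys g = fun k => f (θ^[k] (firstStream sys g, afterFirst sys g)) := by
    intro g
    have : ∀ k, θ^[k] (firstStream sys g, afterFirst sys g)
        = (firstStream sys ((afterFirst sys)^[k] g), (afterFirst sys)^[k + 1] g) := fun k => by
      induction k with
      | zero => rfl
      | succ k ih =>
        rw [Function.iterate_succ_apply', ih, Function.iterate_succ_apply' (afterFirst sys) (k + 1)]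
    funext k
    rw [this k, marks, arrivalStream_eq_iterate, arrivalTime_sub_eq_iterate]
  have heq : (fun g => (arrivalTime sys g 0, marks sys g))
      = (Prod.map id fun z (k : ℕ) => f (θ^[k] z)) ∘
        fun g => (firstTime sys g, firstStream sys g, afterFirst sys g) := by
    funext g
    rw [arrivalTime_zero, hmarks]
    rfl
  have h1 : MeasurePreserving (Prod.map id fun z (k : ℕ) => f (θ^[k] z))
      ((expMeasure (totalRate sys)).prod ((streamLaw sys).prod (gapLaw sys)))
      ((expMeasure (totalRate sys)).prod (marksLaw sys)) :=
    (MeasurePreserving.id _).prod ⟨hV, map_iterate_eq_infinitePi hfm hθm hstep⟩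
  have h2 := h1.comp ⟨hΘ, map_first sys⟩
  rw [heq]
  exact ⟨h2.measurable, h2.map_eq⟩

/-! ### The Markov chain of the states found by the requests -/

/-- The state found by the next request, if a request finds `x` and has mark `v`. -/
def step (sys : System M L) (x : State M L) (v : sys.Stream × ℝ) : State M L :=
  advance sys (request sys v.1.1.1 v.1.1.2 x) v.2

/-- The states found by successive requests with marks `V`, if the first of them finds `x`. -/
def chain (sys : System M L) (x : State M L) (V : ℕ → sys.Stream × ℝ) : ℕ → State M L
  | 0 => x
  | k + 1 => step sys (chain sys x V k) (V k)

/-- The delays of successive requests with marks `V`, if the first of them finds `x`. -/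
def chainDelay (sys : System M L) (x : State M L) (V : ℕ → sys.Stream × ℝ) (k : ℕ) : ℝ :=
  delayIn sys (V k).1.1.1 (chain sys x V k)

/-- The state found by the first request, together with the marks of all requests. -/
def drive (sys : System M L) (ω : Sample sys) : State M L × (ℕ → sys.Stream × ℝ) :=
  (advance sys ω.1 (arrivalTime sys ω.2 0), marks sys ω.2)

/-- The law of the state found by the first request, for the law `μ` of the state at time `0`. -/
def foundLaw (sys : System M L) (μ : Measure (State M L)) : Measure (State M L) :=
  (μ.prod (expMeasure (totalRate sys))).map fun z => advance sys z.1 z.2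

lemma stateFound_eq_chain (sys : System M L) (ω : Sample sys) (k : ℕ) :
    stateFound sys ω k = chain sys (drive sys ω).1 (drive sys ω).2 k := by
  induction k with
  | zero => rfl
  | succ k ih => rw [chain, ← ih]; rfl

lemma delay_eq_chainDelay (sys : System M L) (k : ℕ) (ω : Sample sys) :
    delay sys k ω = chainDelay sys (drive sys ω).1 (drive sys ω).2 k := by
  rw [delay, stateFound_eq_chain]; rfl

lemma measurePreserving_drive (sys : System M L) (μ : Measure (State M L))
    [IsProbabilityMeasure μ] :
    MeasurePreserving (drive sys) (sampleLaw sys μ) ((foundLaw sys μ).prod (marksLaw sys)) := by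
  obtain ⟨hm, hlaw⟩ := map_marks sys
  have h1 : MeasurePreserving (Prod.map id fun g => (arrivalTime sys g 0, marks sys g))
      (sampleLaw sys μ) (μ.prod ((expMeasure (totalRate sys)).prod (marksLaw sys))) :=
    (MeasurePreserving.id μ).prod ⟨hm, hlaw⟩
  have h2 := (measurePreserving_prodAssoc μ (expMeasure (totalRate sys)) (marksLaw sys)).symm
  have h3 : MeasurePreserving (Prod.map (fun z : State M L × ℝ => advance sys z.1 z.2) id)
      ((μ.prod (expMeasure (totalRate sys))).prod (marksLaw sys))
      ((foundLaw sys μ).prod (marksLaw sys)) := by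
    have : IsProbabilityMeasure (foundLaw sys μ) :=
      Measure.isProbabilityMeasure_map (measurable_advance sys).aemeasurable
    exact MeasurePreserving.prod ⟨measurable_advance sys, rfl⟩ (MeasurePreserving.id _)
  exact (h3.comp (h2.comp h1))

lemma isProbabilityMeasure_foundLaw (sys : System M L) (μ : Measure (State M L))
    [IsProbabilityMeasure μ] : IsProbabilityMeasure (foundLaw sys μ) :=
  Measure.isProbabilityMeasure_map (measurable_advance sys).aemeasurable

lemma markLaw_ae_nonneg (sys : System M L) : ∀ᵐ v ∂markLaw sys, 0 ≤ v.2 :=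
  Measure.quasiMeasurePreserving_snd.ae (expMeasure_ae_nonneg _)

lemma marksLaw_ae_nonneg (sys : System M L) : ∀ᵐ V ∂marksLaw sys, ∀ k, 0 ≤ (V k).2 :=
  ae_all_iff.2 fun k =>
    (measurePreserving_eval_infinitePi (fun _ => markLaw sys) k).quasiMeasurePreserving.ae
      (markLaw_ae_nonneg sys)

lemma foundLaw_ae_valid (sys : System M L) {μ : Measure (State M L)} (h : IsInitialLaw sys μ) :
    ∀ᵐ x ∂foundLaw sys μ, ValidState sys x := by
  have := h.1
  rw [foundLaw, ae_map_iff (measurable_advance sys).aemeasurable (measurableSet_validState sys)]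
  filter_upwards [Measure.quasiMeasurePreserving_fst.ae h.2,
    Measure.quasiMeasurePreserving_snd.ae (expMeasure_ae_nonneg (totalRate sys))] with z h1 h2
  exact validState_advance sys h1 h2

lemma measurable_step (sys : System M L) :
    Measurable fun z : State M L × (sys.Stream × ℝ) => step sys z.1 z.2 := by
  have h : Measurable fun z : sys.Stream × State M L => request sys z.1.1.1 z.1.1.2 z.2 :=
    measurable_from_prod_countable_right fun p => measurable_request sys p.1.1 p.1.2
  have h' : Measurable fun z : State M L × (sys.Stream × ℝ) =>
      (request sys z.2.1.1.1 z.2.1.1.2 z.1, z.2.2) :=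
    (h.comp (measurable_snd.fst.prodMk measurable_fst)).prodMk measurable_snd.snd
  exact ((measurable_advance sys).comp h' :)

lemma measurable_chain (sys : System M L) (k : ℕ) :
    Measurable fun z : State M L × (ℕ → sys.Stream × ℝ) => chain sys z.1 z.2 k := by
  induction k with
  | zero => exact measurable_fst
  | succ k ih =>
    exact (measurable_step sys).comp
      (ih.prodMk ((measurable_pi_apply k).comp measurable_snd))

lemma measurable_chainDelay (sys : System M L) (k : ℕ) :
    Measurable fun z : State M L × (ℕ → sys.Stream × ℝ) => chainDelay sys z.1 z.2 k := by
  have h : Measurable fun z : sys.Stream × State M L => delayIn sys z.1.1.1 z.2 :=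
    measurable_from_prod_countable_right fun p => measurable_delayIn sys p.1.1
  have h' : Measurable fun z : State M L × (ℕ → sys.Stream × ℝ) =>
      ((z.2 k).1, chain sys z.1 z.2 k) :=
    (measurable_fst.comp ((measurable_pi_apply k).comp measurable_snd)).prodMk
      (measurable_chain sys k)
  exact (h.comp h' :)

lemma chain_add (sys : System M L) (x : State M L) (V : ℕ → sys.Stream × ℝ) (k n : ℕ) :
    chain sys x V (k + n) = chain sys (chain sys x V k) (shift k V) n := by
  induction n with
  | zero => rfl
  | succ n ih => rw [← add_assoc, chain, ih]; rfl

lemma chainDelay_add (sys : System M L) (x : State M L) (V : ℕ → sys.Stream × ℝ) (k n : ℕ) :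
    chainDelay sys x V (k + n) = chainDelay sys (chain sys x V k) (shift k V) n := by
  rw [chainDelay, chain_add]; rfl

lemma chain_splice (sys : System M L) (x : State M L) (V V' : ℕ → sys.Stream × ℝ) {k j : ℕ}
    (h : j ≤ k) : chain sys x (splice k V V') j = chain sys x V j := by
  induction j with
  | zero => rfl
  | succ j ih => rw [chain, ih (Nat.le_of_succ_le h), splice_of_lt h]; rfl

lemma validState_step (sys : System M L) {x : State M L} (hx : ValidState sys x)
    {v : sys.Stream × ℝ} (hv : 0 ≤ v.2) : ValidState sys (step sys x v) :=
  validState_advance sys (validState_request sys hx _ _) hv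

lemma validState_chain (sys : System M L) {x : State M L} (hx : ValidState sys x)
    {V : ℕ → sys.Stream × ℝ} (hV : ∀ k, 0 ≤ (V k).2) (k : ℕ) :
    ValidState sys (chain sys x V k) := by
  induction k with
  | zero => exact hx
  | succ k ih => exact validState_step sys ih (hV k)

/-- A long gap after a request makes the next request find an empty queue. -/
lemma step_eq_empty (sys : System M L) {x : State M L} (hx : ValidState sys x)
    {v : sys.Stream × ℝ} (hv : workBound sys < v.2) : step sys x v = ([], 0) :=
  advance_eq_empty sys (validState_request sys hx _ _) hv.le

lemma chain_succ_eq_empty (sys : System M L) {x : State M L} (hx : ValidState sys x)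
    {V : ℕ → sys.Stream × ℝ} (hV : ∀ k, 0 ≤ (V k).2) {k : ℕ} (hk : workBound sys < (V k).2) :
    chain sys x V (k + 1) = ([], 0) :=
  step_eq_empty sys (validState_chain sys hx hV k) hk

/-- Coupling: a long gap makes the chain forget its starting point. -/
lemma chain_eq_of_long_gap (sys : System M L) {x x' : State M L} (hx : ValidState sys x)
    (hx' : ValidState sys x') {V : ℕ → sys.Stream × ℝ} (hV : ∀ k, 0 ≤ (V k).2) {i k : ℕ}
    (hik : i < k) (hi : workBound sys < (V i).2) : chain sys x V k = chain sys x' V k := by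
  obtain ⟨n, rfl⟩ := Nat.exists_eq_add_of_le (Nat.succ_le_of_lt hik)
  rw [chain_add, chain_add sys x', Nat.succ_eq_add_one, chain_succ_eq_empty sys hx hV hi,
    chain_succ_eq_empty sys hx' hV hi]

/-! ### Long gaps -/

/-- The marks with a long gap after the request, i.e. one that certainly empties the queue. -/
def longGap (sys : System M L) : Set (sys.Stream × ℝ) := {v | workBound sys < v.2}

lemma measurableSet_longGap (sys : System M L) : MeasurableSet (longGap sys) :=
  measurableSet_lt measurable_const measurable_snd

lemma markLaw_longGap_ne_zero (sys : System M L) : markLaw sys (longGap sys) ≠ 0 := by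
  have : longGap sys = Set.univ ×ˢ Set.Ioi (workBound sys) := by
    ext v; simp [longGap]
  rw [this, markLaw, Measure.prod_prod, measure_univ, one_mul]
  exact expMeasure_Ioi_pos (totalRate_pos sys) (workBound_nonneg sys)

lemma markLaw_longGap_compl_lt_one (sys : System M L) : markLaw sys (longGap sys)ᶜ < 1 := by
  rw [prob_compl_eq_one_sub (measurableSet_longGap sys)]
  exact ENNReal.sub_lt_self ENNReal.one_ne_top one_ne_zero (markLaw_longGap_ne_zero sys)

lemma marksLaw_noLongGap (sys : System M L) (s : Finset ℕ) :
    marksLaw sys {V | ∀ i ∈ s, V i ∉ longGap sys} = (markLaw sys (longGap sys)ᶜ) ^ s.card := by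
  have := Measure.infinitePi_pi (fun _ : ℕ => markLaw sys) (s := s)
    (t := fun _ => (longGap sys)ᶜ) fun i _ => (measurableSet_longGap sys).compl
  rw [Finset.prod_const] at this
  exact this

lemma tendsto_noLongGap (sys : System M L) :
    Tendsto (fun k : ℕ => (markLaw sys (longGap sys)ᶜ) ^ k) atTop (nhds 0) :=
  ENNReal.tendsto_pow_atTop_nhds_zero_of_lt_one (markLaw_longGap_compl_lt_one sys)

/-! ### The stationary law of the chain -/

/-- The part of the law of the state found by the `n`-th request after one that found an empty
queue, on the event that no long gap has occurred in between. -/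
def cycleLaw (sys : System M L) : ℕ → Measure (State M L)
  | 0 => Measure.dirac ([], 0)
  | n + 1 => ((cycleLaw sys n).prod ((markLaw sys).restrict (longGap sys)ᶜ)).map
      fun z => step sys z.1 z.2

/-- The stationary law of the states found by requests: the expected occupation of a cycle between
long gaps, divided by the mean length of the cycle. -/
def stationaryLaw (sys : System M L) : Measure (State M L) :=
  markLaw sys (longGap sys) • Measure.sum (cycleLaw sys)

instance isFiniteMeasure_cycleLaw (sys : System M L) (n : ℕ) :
    IsFiniteMeasure (cycleLaw sys n) := by
  induction n with
  | zero => unfold cycleLaw; infer_instance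
  | succ n ih => unfold cycleLaw; infer_instance

lemma cycleLaw_univ (sys : System M L) (n : ℕ) :
    cycleLaw sys n Set.univ = (markLaw sys (longGap sys)ᶜ) ^ n := by
  induction n with
  | zero => simp [cycleLaw]
  | succ n ih =>
    rw [cycleLaw, Measure.map_apply (measurable_step sys) .univ, Set.preimage_univ,
      ← Set.univ_prod_univ, Measure.prod_prod, ih, Measure.restrict_apply_univ, pow_succ]

lemma cycleLaw_ae_valid (sys : System M L) (n : ℕ) :
    ∀ᵐ x ∂cycleLaw sys n, ValidState sys x := by
  induction n with
  | zero =>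
    rw [cycleLaw, ae_dirac_iff (measurableSet_validState sys)]
    exact validState_empty sys
  | succ n ih =>
    rw [cycleLaw, ae_map_iff (measurable_step sys).aemeasurable (measurableSet_validState sys)]
    filter_upwards [Measure.quasiMeasurePreserving_fst.ae ih,
      Measure.quasiMeasurePreserving_snd.ae (ae_restrict_of_ae (markLaw_ae_nonneg sys))]
      with z h1 h2
    exact validState_step sys h1 h2

lemma tsum_markLaw_longGap (sys : System M L) :
    ∑' n : ℕ, (markLaw sys (longGap sys)ᶜ) ^ n * markLaw sys (longGap sys) = 1 := by
  rw [ENNReal.tsum_mul_right, ENNReal.tsum_geometric,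
    ← prob_compl_eq_one_sub (measurableSet_longGap sys).compl, compl_compl]
  exact ENNReal.inv_mul_cancel (markLaw_longGap_ne_zero sys) (measure_ne_top _ _)

instance (sys : System M L) : IsProbabilityMeasure (stationaryLaw sys) := by
  constructor
  rw [stationaryLaw, Measure.smul_apply, Measure.sum_apply _ .univ, smul_eq_mul,
    ← ENNReal.tsum_mul_left, ← tsum_markLaw_longGap sys]
  exact tsum_congr fun n => by rw [cycleLaw_univ, mul_comm]

lemma stationaryLaw_ae_valid (sys : System M L) :
    ∀ᵐ x ∂stationaryLaw sys, ValidState sys x := by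
  refine Measure.ae_smul_measure ?_ _
  rw [ae_iff, Measure.sum_apply_eq_zero]
  exact fun n => ae_iff.1 (cycleLaw_ae_valid sys n)

/-- One step from the `n`-th state of a cycle either meets a long gap and leads to an empty queue, or
leads to the next state of the cycle. -/
lemma cycleLaw_step (sys : System M L) (n : ℕ) (A : Set (State M L)) :
    ((cycleLaw sys n).prod (markLaw sys)).map (fun z => step sys z.1 z.2) A
      = (markLaw sys (longGap sys)ᶜ) ^ n * markLaw sys (longGap sys)
          * Measure.dirac (([], 0) : State M L) A + cycleLaw sys (n + 1) A := by
  have h1 : ((cycleLaw sys n).prod ((markLaw sys).restrict (longGap sys))).map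
      (fun z => step sys z.1 z.2)
      = ((markLaw sys (longGap sys)ᶜ) ^ n * markLaw sys (longGap sys))
        • Measure.dirac (([], 0) : State M L) := by
    have : (fun z : State M L × (sys.Stream × ℝ) => step sys z.1 z.2)
        =ᵐ[(cycleLaw sys n).prod ((markLaw sys).restrict (longGap sys))] fun _ => ([], 0) := by
      filter_upwards [Measure.quasiMeasurePreserving_fst.ae (cycleLaw_ae_valid sys n),
        Measure.quasiMeasurePreserving_snd.ae (ae_restrict_mem (measurableSet_longGap sys))]
        with z h1 h2
      exact step_eq_empty sys h1 h2
    rw [Measure.map_congr this, Measure.map_const, ← Set.univ_prod_univ, Measure.prod_prod,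
      cycleLaw_univ, Measure.restrict_apply_univ]
  conv_lhs => rw [← Measure.restrict_add_restrict_compl (μ := markLaw sys)
    (measurableSet_longGap sys)]
  rw [Measure.prod_add, Measure.map_add _ _ (measurable_step sys), Measure.add_apply, h1]
  rfl

/-- `stationaryLaw` is invariant: a long gap regenerates the cycle, and without one the chain moves
on within the cycle. -/
lemma map_step_stationaryLaw (sys : System M L) :
    ((stationaryLaw sys).prod (markLaw sys)).map (fun z => step sys z.1 z.2)
      = stationaryLaw sys := by
  ext A hA
  rw [stationaryLaw, Measure.prod_smul_left, Measure.prod_sum_left, Measure.map_smul,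
    Measure.smul_apply, Measure.smul_apply, Measure.map_sum (measurable_step sys).aemeasurable,
    Measure.sum_apply _ hA, Measure.sum_apply _ hA]
  congr 1
  rw [tsum_congr fun n => cycleLaw_step sys n A, ENNReal.tsum_add, ENNReal.tsum_mul_right,
    tsum_markLaw_longGap, one_mul, tsum_eq_zero_add' (f := fun n => cycleLaw sys n A)
      ENNReal.summable]
  rfl

/-- The initial law that makes the delays stationary: the state right after a request that found a
state of law `stationaryLaw`. -/
def stationaryInitialLaw (sys : System M L) : Measure (State M L) :=
  ((stationaryLaw sys).prod (streamLaw sys)).map fun z => request sys z.2.1.1 z.2.1.2 z.1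

lemma measurable_request_stream (sys : System M L) :
    Measurable fun z : State M L × sys.Stream => request sys z.2.1.1 z.2.1.2 z.1 :=
  measurable_from_prod_countable_left fun p => measurable_request sys p.1.1 p.1.2

lemma isInitialLaw_stationary (sys : System M L) : IsInitialLaw sys (stationaryInitialLaw sys) := by
  refine ⟨Measure.isProbabilityMeasure_map (measurable_request_stream sys).aemeasurable, ?_⟩
  rw [stationaryInitialLaw, ae_map_iff (measurable_request_stream sys).aemeasurable
    (measurableSet_validState sys)]
  filter_upwards [Measure.quasiMeasurePreserving_fst.ae (stationaryLaw_ae_valid sys)] with z h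
  exact validState_request sys h _ _

lemma foundLaw_stationaryInitialLaw (sys : System M L) :
    foundLaw sys (stationaryInitialLaw sys) = stationaryLaw sys := by
  have : IsProbabilityMeasure (stationaryInitialLaw sys) := (isInitialLaw_stationary sys).1
  have h1 : MeasurePreserving
      (Prod.map (fun z : State M L × sys.Stream => request sys z.2.1.1 z.2.1.2 z.1) id)
      (((stationaryLaw sys).prod (streamLaw sys)).prod (expMeasure (totalRate sys)))
      ((stationaryInitialLaw sys).prod (expMeasure (totalRate sys))) :=
    MeasurePreserving.prod ⟨measurable_request_stream sys, rfl⟩ (MeasurePreserving.id _)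
  have h2 : MeasurePreserving (fun z : State M L × ℝ => advance sys z.1 z.2)
      ((stationaryInitialLaw sys).prod (expMeasure (totalRate sys)))
      (foundLaw sys (stationaryInitialLaw sys)) := ⟨measurable_advance sys, rfl⟩
  have h3 := (measurePreserving_prodAssoc (stationaryLaw sys) (streamLaw sys)
    (expMeasure (totalRate sys))).symm
  have h4 := ((h2.comp h1).comp h3).map_eq
  rw [← h4]
  exact map_step_stationaryLaw sys

lemma map_head_shift (sys : System M L) :
    MeasurePreserving (fun V : ℕ → sys.Stream × ℝ => (V 0, shift 1 V)) (marksLaw sys)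
      ((markLaw sys).prod (marksLaw sys)) := by
  have hm : Measurable fun V : ℕ → sys.Stream × ℝ => (V 0, shift 1 V) :=
    (measurable_pi_apply 0).prodMk (measurable_shift 1)
  refine ⟨hm, ?_⟩
  have h1 : MeasurePreserving (Prod.map (fun V : ℕ → sys.Stream × ℝ => V 0) id)
      ((marksLaw sys).prod (marksLaw sys)) ((markLaw sys).prod (marksLaw sys)) :=
    (measurePreserving_eval_infinitePi (fun _ => markLaw sys) 0).prod (MeasurePreserving.id _)
  conv_lhs => rw [marksLaw, ← map_splice (markLaw sys) 1]
  have h2 : (fun V : ℕ → sys.Stream × ℝ => (V 0, shift 1 V)) ∘ (fun z => splice 1 z.1 z.2)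
      = Prod.map (fun V => V 0) id :=
    funext fun z => Prod.ext rfl (shift_splice 1 z.1 z.2)
  rw [Measure.map_map hm (measurable_splice 1), h2]
  exact h1.map_eq

lemma measurePreserving_step_shift (sys : System M L) :
    MeasurePreserving (fun z : State M L × (ℕ → sys.Stream × ℝ) =>
        (step sys z.1 (z.2 0), shift 1 z.2))
      ((stationaryLaw sys).prod (marksLaw sys)) ((stationaryLaw sys).prod (marksLaw sys)) := by
  have h1 := (MeasurePreserving.id (stationaryLaw sys)).prod (map_head_shift sys)
  have h2 := (measurePreserving_prodAssoc (stationaryLaw sys) (markLaw sys) (marksLaw sys)).symm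
  have h3 : MeasurePreserving
      (Prod.map (fun z : State M L × (sys.Stream × ℝ) => step sys z.1 z.2) id)
      (((stationaryLaw sys).prod (markLaw sys)).prod (marksLaw sys))
      ((stationaryLaw sys).prod (marksLaw sys)) :=
    MeasurePreserving.prod ⟨measurable_step sys, map_step_stationaryLaw sys⟩
      (MeasurePreserving.id _)
  exact h3.comp (h2.comp h1)

/-- The chain with its future marks is stationary under `stationaryLaw`. -/
lemma measurePreserving_chain_shift (sys : System M L) (k : ℕ) :
    MeasurePreserving (fun z : State M L × (ℕ → sys.Stream × ℝ) =>
        (chain sys z.1 z.2 k, shift k z.2))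
      ((stationaryLaw sys).prod (marksLaw sys)) ((stationaryLaw sys).prod (marksLaw sys)) := by
  induction k with
  | zero =>
    have : (fun z : State M L × (ℕ → sys.Stream × ℝ) => (chain sys z.1 z.2 0, shift 0 z.2))
        = id :=
      funext fun z => Prod.ext rfl (funext fun i => by simp [shift])
    rw [this]
    exact MeasurePreserving.id _
  | succ k ih =>
    have : (fun z : State M L × (ℕ → sys.Stream × ℝ) => (chain sys z.1 z.2 (k + 1),
          shift (k + 1) z.2))
        = (fun z => (step sys z.1 (z.2 0), shift 1 z.2)) ∘
          fun z => (chain sys z.1 z.2 k, shift k z.2) :=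
      funext fun z => Prod.ext rfl (funext fun i => by simp [shift, add_assoc])
    rw [this]
    exact (measurePreserving_step_shift sys).comp ih

/-! ### Stationarity and convergence of the delays -/

/-- The stationary law of the delay sequence. -/
def stationaryDelayLaw (sys : System M L) : Measure (ℕ → ℝ) :=
  ((stationaryLaw sys).prod (marksLaw sys)).map fun z n => chainDelay sys z.1 z.2 n

lemma measurable_delay (sys : System M L) (k : ℕ) : Measurable (delay sys k) := by
  have hm : Measurable (drive sys) :=
    (measurePreserving_drive sys (Measure.dirac (([], 0) : State M L))).measurable
  rw [funext (delay_eq_chainDelay sys k)]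
  exact ((measurable_chainDelay sys k).comp hm :)

lemma measurable_delaySeq (sys : System M L) (k : ℕ) :
    Measurable fun (ω : Sample sys) n => delay sys (k + n) ω :=
  measurable_pi_lambda _ fun n => measurable_delay sys (k + n)

lemma measurable_chainDelaySeq (sys : System M L) (k : ℕ) :
    Measurable fun (z : State M L × (ℕ → sys.Stream × ℝ)) n => chainDelay sys z.1 z.2 (k + n) :=
  measurable_pi_lambda _ fun n => measurable_chainDelay sys (k + n)

lemma delayLawFrom_eq_map (sys : System M L) (μ : Measure (State M L)) [IsProbabilityMeasure μ]
    (k : ℕ) : delayLawFrom sys μ k = ((foundLaw sys μ).prod (marksLaw sys)).map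
      fun z n => chainDelay sys z.1 z.2 (k + n) := by
  rw [← (measurePreserving_drive sys μ).map_eq, Measure.map_map (measurable_chainDelaySeq sys k)
    (measurePreserving_drive sys μ).measurable, delayLawFrom]
  congr 1
  funext ω n
  exact delay_eq_chainDelay sys (k + n) ω

lemma delayLawFrom_stationaryInitialLaw (sys : System M L) (k : ℕ) :
    delayLawFrom sys (stationaryInitialLaw sys) k = stationaryDelayLaw sys := by
  have : IsProbabilityMeasure (stationaryInitialLaw sys) := (isInitialLaw_stationary sys).1
  have hm := measurable_chainDelaySeq sys 0
  simp only [zero_add] at hm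
  rw [delayLawFrom_eq_map, foundLaw_stationaryInitialLaw, stationaryDelayLaw]
  conv_rhs => rw [← (measurePreserving_chain_shift sys k).map_eq]
  rw [Measure.map_map hm (measurePreserving_chain_shift sys k).measurable]
  congr 1
  funext z n
  exact chainDelay_add sys z.1 z.2 k n

lemma isProbabilityMeasure_delayLawFrom (sys : System M L) (μ : Measure (State M L))
    [IsProbabilityMeasure μ] (k : ℕ) : IsProbabilityMeasure (delayLawFrom sys μ k) := by
  have : IsProbabilityMeasure (sampleLaw sys μ) := by unfold sampleLaw; infer_instance
  exact Measure.isProbabilityMeasure_map (measurable_delaySeq sys k).aemeasurable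

lemma isStationaryLaw_stationaryDelayLaw (sys : System M L) :
    IsStationaryLaw sys (stationaryDelayLaw sys) :=
  ⟨_, isInitialLaw_stationary sys, delayLawFrom_stationaryInitialLaw sys⟩

/-- Two events that coincide outside of `B` differ in probability by at most that of `B`. -/
lemma abs_measureReal_sub_le {Ω : Type*} [MeasurableSpace Ω] (P : Measure Ω) [IsFiniteMeasure P]
    {E F B : Set Ω} (h : ∀ᵐ ω ∂P, ω ∉ B → (ω ∈ E ↔ ω ∈ F)) :
    |P.real E - P.real F| ≤ P.real B := by
  have key : ∀ E F : Set Ω, (∀ᵐ ω ∂P, ω ∉ B → (ω ∈ E → ω ∈ F)) →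
      P.real E ≤ P.real F + P.real B := fun E F h => by
    refine le_trans ?_ (measureReal_union_le F B)
    refine ENNReal.toReal_mono (measure_ne_top _ _) (measure_mono_ae ?_)
    filter_upwards [h] with ω h hE
    by_cases hB : ω ∈ B
    · exact Or.inr hB
    · exact Or.inl (h hB hE)
  rw [abs_sub_le_iff]
  constructor
  · linarith [key E F (h.mono fun ω h hB => (h hB).1)]
  · linarith [key F E (h.mono fun ω h hB => (h hB).2)]

/-- The probability that none of `k` successive gaps is long. -/
def couplingBound (sys : System M L) (k : ℕ) : ℝ := ((markLaw sys (longGap sys)ᶜ) ^ k).toReal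

lemma couplingBound_nonneg (sys : System M L) (k : ℕ) : 0 ≤ couplingBound sys k :=
  ENNReal.toReal_nonneg

lemma tendsto_couplingBound (sys : System M L) :
    Tendsto (fun k => 2 * couplingBound sys k) atTop (nhds 0) := by
  have := (ENNReal.tendsto_toReal ENNReal.zero_ne_top).comp (tendsto_noLongGap sys)
  simpa [couplingBound] using this.const_mul 2

/-- Compared with the start from an empty queue, the law of the delays differs by at most the
probability that no long gap has occurred. -/
lemma abs_delayLawFrom_sub_empty_le (sys : System M L) {μ : Measure (State M L)}
    (hμ : IsInitialLaw sys μ) (k : ℕ) {A : Set (ℕ → ℝ)} (hA : MeasurableSet A) :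
    |(delayLawFrom sys μ k).real A
      - (marksLaw sys).real {V | (fun n => chainDelay sys ([], 0) V (k + n)) ∈ A}|
      ≤ couplingBound sys k := by
  have := hμ.1
  have := isProbabilityMeasure_foundLaw sys μ
  have hF : (marksLaw sys).real {V | (fun n => chainDelay sys ([], 0) V (k + n)) ∈ A}
      = ((foundLaw sys μ).prod (marksLaw sys)).real
        (Set.univ ×ˢ {V | (fun n => chainDelay sys ([], 0) V (k + n)) ∈ A}) := by
    rw [measureReal_prod_prod, probReal_univ, one_mul]
  have hB : couplingBound sys k = ((foundLaw sys μ).prod (marksLaw sys)).real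
        (Set.univ ×ˢ {V | ∀ i ∈ Finset.range k, V i ∉ longGap sys}) := by
    rw [measureReal_prod_prod, probReal_univ, one_mul, measureReal_def, marksLaw_noLongGap,
      Finset.card_range, couplingBound]
  rw [delayLawFrom_eq_map, map_measureReal_apply (measurable_chainDelaySeq sys k) hA, hF, hB]
  refine abs_measureReal_sub_le _ ?_
  filter_upwards [Measure.quasiMeasurePreserving_fst.ae (foundLaw_ae_valid sys hμ),
    Measure.quasiMeasurePreserving_snd.ae (marksLaw_ae_nonneg sys)] with z hz hV hB
  simp only [Set.mem_prod, Set.mem_univ, true_and, Set.mem_ofPred_eq, not_forall, not_not,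
    Finset.mem_range] at hB
  obtain ⟨i, hik, hi⟩ := hB
  have : ∀ n, chainDelay sys z.1 z.2 (k + n) = chainDelay sys ([], 0) z.2 (k + n) := fun n => by
    rw [chainDelay, chainDelay, chain_eq_of_long_gap sys hz (validState_empty sys) hV
      (lt_of_lt_of_le hik (Nat.le_add_right k n)) hi]
  simp only [Set.mem_preimage, this, Set.mem_prod, Set.mem_univ, true_and, Set.mem_ofPred_eq]

lemma abs_delayLawFrom_sub_stationary_le (sys : System M L) {μ : Measure (State M L)}
    (hμ : IsInitialLaw sys μ) (k : ℕ) {A : Set (ℕ → ℝ)} (hA : MeasurableSet A) :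
    |(delayLawFrom sys μ k).real A - (stationaryDelayLaw sys).real A|
      ≤ 2 * couplingBound sys k := by
  have h1 := abs_delayLawFrom_sub_empty_le sys hμ k hA
  have h2 := abs_delayLawFrom_sub_empty_le sys (isInitialLaw_stationary sys) k hA
  rw [delayLawFrom_stationaryInitialLaw] at h2
  rw [abs_le] at *
  constructor <;> linarith [h1.1, h1.2, h2.1, h2.2]

lemma map_delayLawFrom (sys : System M L) (μ : Measure (State M L)) (k : ℕ) :
    (delayLawFrom sys μ k).map (fun x => x 0) = (sampleLaw sys μ).map (delay sys k) := by
  rw [delayLawFrom, Measure.map_map (measurable_pi_apply 0) (measurable_delaySeq sys k)]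
  rfl

lemma abs_map_delay_sub_stationary_le (sys : System M L) {μ : Measure (State M L)}
    (hμ : IsInitialLaw sys μ) (k : ℕ) {A : Set ℝ} (hA : MeasurableSet A) :
    |((sampleLaw sys μ).map (delay sys k)).real A
      - ((stationaryDelayLaw sys).map fun x => x 0).real A| ≤ 2 * couplingBound sys k := by
  have hm : Measurable fun x : ℕ → ℝ => x 0 := measurable_pi_apply 0
  rw [← map_delayLawFrom, map_measureReal_apply hm hA, map_measureReal_apply hm hA]
  exact abs_delayLawFrom_sub_stationary_le sys hμ k (hm hA)

lemma tendsto_tvDist {α : Type*} [MeasurableSpace α] {P : ℕ → Measure α} {Q : Measure α}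
    {c : ℕ → ℝ} (hc0 : ∀ k, 0 ≤ c k) (hc : Tendsto c atTop (nhds 0))
    (h : ∀ k A, MeasurableSet A → |(P k).real A - Q.real A| ≤ c k) :
    Tendsto (fun k => tvDist (P k) Q) atTop (nhds 0) :=
  squeeze_zero (fun _ => Real.iSup_nonneg fun _ => abs_nonneg _)
    (fun k => Real.iSup_le (fun A => h k A A.2) (hc0 k)) hc

lemma measure_eq_of_abs_sub_le {α : Type*} [MeasurableSpace α] {P Q : Measure α}
    [IsFiniteMeasure P] [IsFiniteMeasure Q] {c : ℕ → ℝ} (hc : Tendsto c atTop (nhds 0))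
    (h : ∀ k A, MeasurableSet A → |P.real A - Q.real A| ≤ c k) : P = Q := by
  ext A hA
  have h0 : |P.real A - Q.real A| ≤ 0 := ge_of_tendsto' hc fun k => h k A hA
  have h1 : P.real A = Q.real A := sub_eq_zero.1 (abs_nonpos_iff.1 h0)
  exact (ENNReal.toReal_eq_toReal_iff' (measure_ne_top _ _) (measure_ne_top _ _)).1 h1

/-! ### Regeneration epochs -/

/-- The requests that follow a long gap; `b` says whether the `0`-th one counts as such. -/
def afterLongGap (sys : System M L) (b : Prop) (V : ℕ → sys.Stream × ℝ) : ℕ → Prop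
  | 0 => b
  | j + 1 => V j ∈ longGap sys

/-- The index of the `n`-th request that follows a long gap. -/
def epoch (sys : System M L) (b : Prop) (V : ℕ → sys.Stream × ℝ) (n : ℕ) : ℕ :=
  Nat.nth (afterLongGap sys b V) n

/-- The mark sequences with nonnegative gaps and infinitely many long gaps. -/
def Regular (sys : System M L) (V : ℕ → sys.Stream × ℝ) : Prop :=
  (∀ k, 0 ≤ (V k).2) ∧ ∀ N, ∃ i, N ≤ i ∧ V i ∈ longGap sys

lemma marksLaw_ae_regular (sys : System M L) : ∀ᵐ V ∂marksLaw sys, Regular sys V := by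
  refine (marksLaw_ae_nonneg sys).and (ae_all_iff.2 fun N => ?_)
  rw [ae_iff]
  refine le_antisymm (ge_of_tendsto' (tendsto_noLongGap sys) fun k => ?_) zero_le
  have := marksLaw_noLongGap sys (Finset.Ico N (N + k))
  rw [Nat.card_Ico, Nat.add_sub_cancel_left] at this
  rw [← this]
  refine measure_mono fun V hV i hi h => hV ⟨i, (Finset.mem_Ico.1 hi).1, h⟩

lemma Regular.infinite {sys : System M L} {V : ℕ → sys.Stream × ℝ} (h : Regular sys V)
    (b : Prop) : (Set.ofPred (afterLongGap sys b V)).Infinite :=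
  Set.infinite_of_forall_exists_gt fun N => by
    obtain ⟨i, hi, hV⟩ := h.2 N
    exact ⟨i + 1, hV, Nat.lt_succ_of_le hi⟩

lemma measurableSet_afterLongGap (sys : System M L) (b : Prop) (j : ℕ) :
    MeasurableSet {V | afterLongGap sys b V j} := by
  cases j with
  | zero => exact MeasurableSet.const b
  | succ j => exact measurable_pi_apply j (measurableSet_longGap sys)

open Classical in
/-- The second alternative is the value `0` of `Nat.nth p n` if `p` holds at most `n` times. -/
lemma nth_eq_iff (p : ℕ → Prop) (n k : ℕ) : Nat.nth p n = k ↔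
    (p k ∧ Nat.count p k = n) ∨ (k = 0 ∧ ∀ j, ¬ (p j ∧ Nat.count p j = n)) := by
  have huniq : ∀ j, p j → Nat.count p j = n → Nat.nth p n = j := fun j hj hc => by
    rw [← hc, Nat.nth_count hj]
  constructor
  · intro h
    by_cases hex : ∃ j, p j ∧ Nat.count p j = n
    · obtain ⟨j, hj, hc⟩ := hex
      have : j = k := (huniq j hj hc).symm.trans h
      exact Or.inl (this ▸ ⟨hj, hc⟩)
    · refine Or.inr ⟨?_, fun j hj => hex ⟨j, hj⟩⟩
      rw [← h, Nat.nth_eq_zero]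
      right
      by_contra hcon
      have hcon' : ∀ hf : (Set.ofPred p).Finite, n < hf.toFinset.card := fun hf => by
        by_contra hle
        exact hcon ⟨hf, not_lt.1 hle⟩
      exact hex ⟨_, Nat.nth_mem n hcon', Nat.count_nth hcon'⟩
  · rintro (⟨h1, h2⟩ | ⟨rfl, h⟩)
    · exact huniq k h1 h2
    · rw [Nat.nth_eq_zero]
      by_contra hcon
      push Not at hcon
      exact h _ ⟨Nat.nth_mem n hcon.2, Nat.count_nth hcon.2⟩

lemma measurable_epoch (sys : System M L) (b : Prop) (n : ℕ) :
    Measurable fun V => epoch sys b V n := by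
  classical
  have hcount : ∀ j, Measurable fun V => Nat.count (afterLongGap sys b V) j := fun j => by
    induction j with
    | zero => simp only [Nat.count_zero]; exact measurable_const
    | succ j ih =>
      simp only [Nat.count_succ]
      exact ih.add (Measurable.ite (measurableSet_afterLongGap sys b j) measurable_const
        measurable_const)
  have hset : ∀ j, MeasurableSet {V | afterLongGap sys b V j ∧
      Nat.count (afterLongGap sys b V) j = n} := fun j =>
    (measurableSet_afterLongGap sys b j).inter (hcount j (measurableSet_singleton n))
  refine measurable_to_countable' fun k => ?_
  have : (fun V => epoch sys b V n) ⁻¹' {k}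
      = {V | afterLongGap sys b V k ∧ Nat.count (afterLongGap sys b V) k = n} ∪
        ({_V | k = 0} ∩ ⋂ j, {V | afterLongGap sys b V j ∧
          Nat.count (afterLongGap sys b V) j = n}ᶜ) := by
    ext V
    simp only [Set.mem_preimage, Set.mem_singleton_iff, epoch, nth_eq_iff, Set.mem_union,
      Set.mem_inter_iff, Set.mem_iInter, Set.mem_compl_iff, Set.mem_ofPred_eq]
  rw [this]
  exact (hset k).union ((MeasurableSet.const _).inter (MeasurableSet.iInter fun j =>
    (hset j).compl))

/-- Seen from its `n`-th element, an infinite set of natural numbers is enumerated by the later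
elements of its enumeration. -/
lemma nth_add_eq {p : ℕ → Prop} (hp : (Set.ofPred p).Infinite) (n m : ℕ) :
    Nat.nth p (n + m) = Nat.nth p n + Nat.nth (fun j => p (Nat.nth p n + j)) m := by
  classical
  set k := Nat.nth p n with hk
  have hq : (Set.ofPred fun j => p (k + j)).Infinite :=
    Set.infinite_of_forall_exists_gt fun N => by
      obtain ⟨i, hi, hlt⟩ := hp.exists_gt (k + N)
      refine ⟨i - k, ?_, by omega⟩
      change p (k + (i - k))
      rwa [Nat.add_sub_cancel' (by omega)]
  have hmem : p (k + Nat.nth (fun j => p (k + j)) m) := Nat.nth_mem_of_infinite hq m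
  rw [← Nat.nth_count hmem, Nat.count_add, hk, Nat.count_nth_of_infinite hp, ← hk,
    Nat.count_nth_of_infinite hq]

lemma afterLongGap_epoch {sys : System M L} {V : ℕ → sys.Stream × ℝ} (h : Regular sys V)
    (b : Prop) (n : ℕ) : afterLongGap sys b V (epoch sys b V n) :=
  Nat.nth_mem_of_infinite (h.infinite b) n

lemma epoch_add {sys : System M L} {V : ℕ → sys.Stream × ℝ} (h : Regular sys V) (n m : ℕ) :
    epoch sys False V (n + m) = epoch sys False V n
      + epoch sys True (shift (epoch sys False V n) V) m := by
  have hmem := afterLongGap_epoch h False n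
  rw [epoch, nth_add_eq (h.infinite False)]
  simp only [epoch] at hmem ⊢
  congr 2
  funext j
  cases j with
  | zero => exact propext ⟨fun _ => trivial, fun _ => hmem⟩
  | succ j => rfl

lemma chain_epoch {sys : System M L} {V : ℕ → sys.Stream × ℝ} (h : Regular sys V)
    {x : State M L} (hx : ValidState sys x) (n : ℕ) :
    chain sys x V (epoch sys False V n) = ([], 0) := by
  have hmem := afterLongGap_epoch h False n
  cases hk : epoch sys False V n with
  | zero => rw [hk] at hmem; exact hmem.elim
  | succ k => rw [hk] at hmem; exact chain_succ_eq_empty sys hx h.1 hmem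

/-- An epoch is a stopping time: whether it is at most `k` is determined by the marks before `k`. -/
lemma epoch_eq_of_agree {sys : System M L} {V V' : ℕ → sys.Stream × ℝ} (h : Regular sys V)
    {b : Prop} {k : ℕ} (hVV' : ∀ i < k, V i = V' i) {n : ℕ} (hn : epoch sys b V n ≤ k) :
    epoch sys b V' n = epoch sys b V n := by
  classical
  have hmark : ∀ j ≤ k, (afterLongGap sys b V j ↔ afterLongGap sys b V' j) := fun j hj => by
    cases j with
    | zero => exact Iff.rfl
    | succ j => rw [afterLongGap, afterLongGap, hVV' j hj]
  have hcount : ∀ j ≤ k,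
      Nat.count (afterLongGap sys b V) j = Nat.count (afterLongGap sys b V') j := fun j hj => by
    induction j with
    | zero => simp
    | succ j ih =>
      rw [Nat.count_succ, Nat.count_succ, ih (Nat.le_of_succ_le hj)]
      simp only [hmark j (Nat.le_of_succ_le hj)]
  have h1 := (hmark _ hn).1 (afterLongGap_epoch h b n)
  have h2 := hcount _ hn
  conv_rhs => rw [← Nat.nth_count h1, ← h2]
  rw [epoch, epoch, Nat.count_nth_of_infinite (h.infinite b)]

/-! ### The regeneration property -/

/-- The past of the `n`-th epoch: the epochs so far and the delays strictly before the epoch. -/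
def pastOf (sys : System M L) (n : ℕ) (z : State M L × (ℕ → sys.Stream × ℝ)) :
    (ℕ → ℕ) × (ℕ → ℝ) :=
  (fun m => epoch sys False z.2 (min m n),
    fun k => if k < epoch sys False z.2 n then chainDelay sys z.1 z.2 k else 0)

/-- The future of the `n`-th epoch: the epochs and the delays, seen from the epoch. -/
def futureOf (sys : System M L) (n : ℕ) (z : State M L × (ℕ → sys.Stream × ℝ)) :
    (ℕ → ℕ) × (ℕ → ℝ) :=
  (fun m => epoch sys False z.2 (n + m) - epoch sys False z.2 n,
    fun k => chainDelay sys z.1 z.2 (epoch sys False z.2 n + k))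

/-- The epochs and the delays if the first request is an epoch and finds an empty queue. -/
def freshStart (sys : System M L) (V : ℕ → sys.Stream × ℝ) : (ℕ → ℕ) × (ℕ → ℝ) :=
  (fun m => epoch sys True V m, fun k => chainDelay sys ([], 0) V k)

lemma measurable_epoch_snd (sys : System M L) (n : ℕ) :
    Measurable fun z : State M L × (ℕ → sys.Stream × ℝ) => epoch sys False z.2 n :=
  (measurable_epoch sys False n).comp measurable_snd

lemma measurable_pastOf (sys : System M L) (n : ℕ) : Measurable (pastOf sys n) := by
  refine Measurable.prodMk (measurable_pi_lambda _ fun m => measurable_epoch_snd sys _)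
    (measurable_pi_lambda _ fun k => ?_)
  exact Measurable.ite (measurableSet_lt measurable_const (measurable_epoch_snd sys n))
    (measurable_chainDelay sys k) measurable_const

lemma measurable_futureOf (sys : System M L) (n : ℕ) : Measurable (futureOf sys n) := by
  refine Measurable.prodMk (measurable_pi_lambda _ fun m =>
    (measurable_epoch_snd sys _).sub (measurable_epoch_snd sys n))
    (measurable_pi_lambda _ fun k => ?_)
  have h : Measurable fun y : ℕ × (State M L × (ℕ → sys.Stream × ℝ)) =>
      chainDelay sys y.2.1 y.2.2 (y.1 + k) :=
    measurable_from_prod_countable_right fun j => measurable_chainDelay sys (j + k)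
  exact (h.comp ((measurable_epoch_snd sys n).prodMk measurable_id) :)

lemma measurable_freshStart (sys : System M L) : Measurable (freshStart sys) := by
  refine Measurable.prodMk (measurable_pi_lambda _ fun m => measurable_epoch sys True m)
    (measurable_pi_lambda _ fun k => ?_)
  exact ((measurable_chainDelay sys k).comp (measurable_const.prodMk measurable_id) :)

lemma futureOf_eq {sys : System M L} {V : ℕ → sys.Stream × ℝ} (h : Regular sys V)
    {x : State M L} (hx : ValidState sys x) (n : ℕ) :
    futureOf sys n (x, V) = freshStart sys (shift (epoch sys False V n) V) := by
  refine Prod.ext (funext fun m => ?_) (funext fun k => ?_)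
  · simp only [futureOf, freshStart, epoch_add h n m, Nat.add_sub_cancel_left]
  · simp only [futureOf, freshStart, chainDelay_add, chain_epoch h hx]

/-- If the `n`-th epoch is `k`, then its past is determined by the marks before `k`. -/
lemma pastOf_eq_of_agree {sys : System M L} {V V' : ℕ → sys.Stream × ℝ} (h : Regular sys V)
    (x : State M L) {k n : ℕ} (hn : epoch sys False V n = k) :
    pastOf sys n (x, splice k V V') = pastOf sys n (x, V) := by
  have hagree : ∀ i < k, V i = splice k V V' i := fun i hi => (splice_of_lt hi V V').symm
  have hepoch : ∀ m, epoch sys False (splice k V V') (min m n) = epoch sys False V (min m n) :=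
    fun m => epoch_eq_of_agree h hagree
      (hn ▸ Nat.nth_monotone (h.infinite False) (min_le_right m n))
  have hepoch' := hepoch n
  rw [min_self] at hepoch'
  refine Prod.ext (funext fun m => hepoch m) (funext fun j => ?_)
  simp only [pastOf, hepoch', hn]
  split_ifs with hj
  · rw [chainDelay, chainDelay, chain_splice sys x V V' hj.le, splice_of_lt hj]
  · rfl

/-- An event determined by the marks before `k` is independent of the marks from `k` on. -/
lemma measure_inter_shift (sys : System M L) (η : Measure (State M L)) [IsProbabilityMeasure η]
    (k : ℕ) {E : Set (State M L × (ℕ → sys.Stream × ℝ))} (hE : MeasurableSet E)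
    {C : Set (ℕ → sys.Stream × ℝ)} (hC : MeasurableSet C)
    (h : ∀ᵐ y ∂η.prod ((marksLaw sys).prod (marksLaw sys)),
      ((y.1, splice k y.2.1 y.2.2) ∈ E ↔ (y.1, y.2.1) ∈ E)) :
    (η.prod (marksLaw sys)) (E ∩ (fun z => shift k z.2) ⁻¹' C)
      = (η.prod (marksLaw sys)) E * marksLaw sys C := by
  have h1 : MeasurePreserving
      (Prod.map id fun z : (ℕ → sys.Stream × ℝ) × (ℕ → sys.Stream × ℝ) => splice k z.1 z.2)
      (η.prod ((marksLaw sys).prod (marksLaw sys))) (η.prod (marksLaw sys)) :=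
    (MeasurePreserving.id η).prod ⟨measurable_splice k, map_splice (markLaw sys) k⟩
  have h2 := (measurePreserving_prodAssoc η (marksLaw sys) (marksLaw sys)).symm
  have hC' : MeasurableSet ((fun z : State M L × (ℕ → sys.Stream × ℝ) => shift k z.2) ⁻¹' C) :=
    ((measurable_shift k).comp measurable_snd) hC
  rw [← h1.measure_preimage (hE.inter hC').nullMeasurableSet, ← Measure.prod_prod,
    ← h2.measure_preimage (hE.prod hC).nullMeasurableSet]
  refine measure_congr ?_
  filter_upwards [h] with y hy
  refine propext ?_
  change (y.1, splice k y.2.1 y.2.2) ∈ E ∧ shift k (splice k y.2.1 y.2.2) ∈ C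
    ↔ (y.1, y.2.1) ∈ E ∧ y.2.2 ∈ C
  rw [shift_splice, hy]

lemma measure_eq_tsum_fiber {Ω : Type*} [MeasurableSpace Ω] (P : Measure Ω) {S : Ω → ℕ}
    (hS : Measurable S) {X : Set Ω} (hX : MeasurableSet X) :
    P X = ∑' k, P (X ∩ S ⁻¹' {k}) := by
  rw [← measure_iUnion, ← Set.inter_iUnion, ← Set.preimage_iUnion, Set.iUnion_of_singleton,
    Set.preimage_univ, Set.inter_univ]
  · intro i j hij
    refine Set.disjoint_left.2 fun ω h1 h2 => hij ?_
    exact h1.2.symm.trans h2.2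
  · exact fun k => hX.inter (hS (measurableSet_singleton k))

/-- At each epoch the past is independent of the future, and the latter is a fresh start. -/
lemma measure_past_inter_future (sys : System M L) {η : Measure (State M L)}
    [IsProbabilityMeasure η] (hη : ∀ᵐ x ∂η, ValidState sys x) (n : ℕ)
    {A B : Set ((ℕ → ℕ) × (ℕ → ℝ))} (hA : MeasurableSet A) (hB : MeasurableSet B) :
    (η.prod (marksLaw sys)) (pastOf sys n ⁻¹' A ∩ futureOf sys n ⁻¹' B)
      = (η.prod (marksLaw sys)) (pastOf sys n ⁻¹' A)
        * (marksLaw sys).map (freshStart sys) B := by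
  have hS := measurable_epoch_snd sys n
  have hA' := measurable_pastOf sys n hA
  have hB' := measurable_futureOf sys n hB
  have hB'' := measurable_freshStart sys hB
  have hreg : ∀ᵐ z ∂η.prod (marksLaw sys), Regular sys z.2 :=
    Measure.quasiMeasurePreserving_snd.ae (marksLaw_ae_regular sys)
  rw [measure_eq_tsum_fiber _ hS (hA'.inter hB'), measure_eq_tsum_fiber _ hS hA',
    ← ENNReal.tsum_mul_right]
  refine tsum_congr fun k => ?_
  have hE := hA'.inter (hS (measurableSet_singleton k))
  rw [Measure.map_apply (measurable_freshStart sys) hB, ← measure_inter_shift sys η k hE hB'']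
  · refine measure_congr ?_
    filter_upwards [hreg, Measure.quasiMeasurePreserving_fst.ae hη] with z hz hx
    refine propext ⟨?_, ?_⟩
    · rintro ⟨⟨h1, h2⟩, h3⟩
      refine ⟨⟨h1, h3⟩, ?_⟩
      have h3' : epoch sys False z.2 n = k := h3
      have h2' : futureOf sys n (z.1, z.2) ∈ B := h2
      rw [futureOf_eq hz hx, h3'] at h2'
      exact h2'
    · rintro ⟨⟨h1, h3⟩, h2⟩
      refine ⟨⟨h1, ?_⟩, h3⟩
      have h3' : epoch sys False z.2 n = k := h3
      change futureOf sys n (z.1, z.2) ∈ B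
      rw [futureOf_eq hz hx, h3']
      exact h2
  · have hreg1 : ∀ᵐ y ∂η.prod ((marksLaw sys).prod (marksLaw sys)), Regular sys y.2.1 :=
      Measure.quasiMeasurePreserving_snd.ae
        (Measure.quasiMeasurePreserving_fst.ae (marksLaw_ae_regular sys))
    have hsp : MeasurePreserving
        (fun z : (ℕ → sys.Stream × ℝ) × (ℕ → sys.Stream × ℝ) => splice k z.1 z.2)
        ((marksLaw sys).prod (marksLaw sys)) (marksLaw sys) :=
      ⟨measurable_splice k, map_splice (markLaw sys) k⟩
    have hreg2 : ∀ᵐ y ∂η.prod ((marksLaw sys).prod (marksLaw sys)),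
        Regular sys (splice k y.2.1 y.2.2) :=
      Measure.quasiMeasurePreserving_snd.ae
        (hsp.quasiMeasurePreserving.ae (marksLaw_ae_regular sys))
    filter_upwards [hreg1, hreg2] with y hy1 hy2
    have hiff : epoch sys False (splice k y.2.1 y.2.2) n = k ↔ epoch sys False y.2.1 n = k := by
      constructor
      · intro h
        rw [← h]
        exact epoch_eq_of_agree hy2 (fun i hi => splice_of_lt (h ▸ hi) _ _) le_rfl
      · intro h
        conv_rhs => rw [← h]
        exact epoch_eq_of_agree hy1 (fun i hi => (splice_of_lt hi _ _).symm) h.le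
    change (pastOf sys n (y.1, splice k y.2.1 y.2.2) ∈ A ∧
        epoch sys False (splice k y.2.1 y.2.2) n = k)
      ↔ (pastOf sys n (y.1, y.2.1) ∈ A ∧ epoch sys False y.2.1 n = k)
    rw [hiff]
    refine and_congr_left fun hk => ?_
    rw [pastOf_eq_of_agree hy1 y.1 hk]

/-- The regeneration epochs: the requests that follow a long gap. -/
def regenerationEpoch (sys : System M L) (n : ℕ) (ω : Sample sys) : ℕ :=
  epoch sys False (marks sys ω.2) n

/-- The law of the future of a regeneration epoch. -/
def futureLaw (sys : System M L) : Measure ((ℕ → ℕ) × (ℕ → ℝ)) :=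
  (marksLaw sys).map (freshStart sys)

lemma future_eq (sys : System M L) (n : ℕ) :
    (fun ω => ((fun m => regenerationEpoch sys (n + m) ω - regenerationEpoch sys n ω : ℕ → ℕ),
      (fun k => delay sys (regenerationEpoch sys n ω + k) ω : ℕ → ℝ)))
      = futureOf sys n ∘ drive sys := by
  funext ω
  simp only [delay_eq_chainDelay]
  rfl

lemma past_eq (sys : System M L) (n : ℕ) :
    (fun ω => ((fun m => regenerationEpoch sys (min m n) ω : ℕ → ℕ),
      (fun k => if k < regenerationEpoch sys n ω then delay sys k ω else 0 : ℕ → ℝ)))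
      = pastOf sys n ∘ drive sys := by
  funext ω
  simp only [delay_eq_chainDelay]
  rfl

lemma isRegenerative_delay (sys : System M L) {μ : Measure (State M L)}
    (hμ : IsInitialLaw sys μ) :
    IsRegenerative (sampleLaw sys μ) (delay sys) (regenerationEpoch sys) (futureLaw sys) := by
  have := hμ.1
  have hη := isProbabilityMeasure_foundLaw sys μ
  have hd := measurePreserving_drive sys μ
  have hvalid := foundLaw_ae_valid sys hμ
  have hfut : ∀ (n : ℕ) {B : Set ((ℕ → ℕ) × (ℕ → ℝ))}, MeasurableSet B →
      ((foundLaw sys μ).prod (marksLaw sys)) (futureOf sys n ⁻¹' B) = futureLaw sys B :=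
    fun n B hB => by
      have := measure_past_inter_future sys hvalid n MeasurableSet.univ hB
      rwa [Set.preimage_univ, Set.univ_inter, measure_univ, one_mul] at this
  refine ⟨measurable_delay sys, fun n => ?_, ?_, fun n => ?_, fun n => ?_⟩
  · exact ((measurable_epoch_snd sys n).comp hd.measurable :)
  · filter_upwards [hd.quasiMeasurePreserving.ae
      (Measure.quasiMeasurePreserving_snd.ae (marksLaw_ae_regular sys))] with ω hω
    exact Nat.nth_strictMono (hω.infinite False)
  · rw [future_eq]
    ext B hB
    rw [Measure.map_apply ((measurable_futureOf sys n).comp hd.measurable) hB, Set.preimage_comp,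
      hd.measure_preimage (measurable_futureOf sys n hB).nullMeasurableSet, hfut n hB]
  · rw [future_eq, past_eq, indepFun_iff_measure_inter_preimage_eq_mul]
    intro A B hA hB
    have hA' := measurable_pastOf sys n hA
    have hB' := measurable_futureOf sys n hB
    rw [Set.preimage_comp, Set.preimage_comp, ← Set.preimage_inter,
      hd.measure_preimage (hA'.inter hB').nullMeasurableSet,
      hd.measure_preimage hA'.nullMeasurableSet, hd.measure_preimage hB'.nullMeasurableSet,
      hfut n hB, measure_past_inter_future sys hvalid n hA hB, futureLaw]

/-! ### The length of a regeneration cycle -/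

lemma noLongGap_of_lt_epoch {sys : System M L} {V : ℕ → sys.Stream × ℝ} (h : Regular sys V)
    {j i : ℕ} (hj : j < epoch sys True V 1) (hi : i < j) : V i ∉ longGap sys := by
  classical
  intro hV
  have hc : Nat.count (afterLongGap sys True V) 1 = 1 := by
    rw [Nat.count_one, if_pos (show afterLongGap sys True V 0 from trivial)]
  have h0 : Nat.count (afterLongGap sys True V) 1 ≤ Nat.count (afterLongGap sys True V) (i + 1) :=
    Nat.count_monotone _ (by omega)
  have h1 : 1 < Nat.count (afterLongGap sys True V) (i + 2) := by
    rw [Nat.count_succ, if_pos (show afterLongGap sys True V (i + 1) from hV)]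
    omega
  have h2 : epoch sys True V 1 < i + 2 := (Nat.lt_nth_iff_count_lt (h.infinite True)).1 h1
  omega

lemma integrable_epoch_one (sys : System M L) :
    Integrable (fun V => (epoch sys True V 1 : ℝ)) (marksLaw sys) := by
  have hm := measurable_epoch sys True 1
  have hset : ∀ j, MeasurableSet {V | j < epoch sys True V 1} := fun j =>
    measurableSet_lt measurable_const hm
  refine ⟨(measurable_from_nat.comp hm).aestronglyMeasurable, ?_⟩
  -- the mean is the sum of the tails, which are geometric
  have hsum : ∀ n : ℕ, ‖(n : ℝ)‖ₑ = ∑' j : ℕ, if j < n then (1 : ENNReal) else 0 := fun n => by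
    rw [tsum_eq_sum (s := Finset.range n) fun j hj => if_neg (by simpa using hj),
      Finset.sum_congr rfl fun j hj => if_pos (Finset.mem_range.1 hj)]
    simp
  have htail : ∀ j, marksLaw sys {V | j < epoch sys True V 1}
      ≤ (markLaw sys (longGap sys)ᶜ) ^ j := fun j => by
    have := marksLaw_noLongGap sys (Finset.range j)
    rw [Finset.card_range] at this
    rw [← this]
    refine measure_mono_ae ?_
    filter_upwards [marksLaw_ae_regular sys] with V hV hj i hi
    exact noLongGap_of_lt_epoch hV hj (Finset.mem_range.1 hi)
  calc ∫⁻ V, ‖(epoch sys True V 1 : ℝ)‖ₑ ∂marksLaw sys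
      = ∑' j, marksLaw sys {V | j < epoch sys True V 1} := by
        simp only [hsum]
        rw [lintegral_tsum fun j => (Measurable.ite (hset j) measurable_const
          measurable_const).aemeasurable]
        refine tsum_congr fun j => ?_
        rw [← lintegral_indicator_one (hset j)]
        exact lintegral_congr fun V => by simp [Set.indicator_apply]
    _ ≤ ∑' j : ℕ, (markLaw sys (longGap sys)ᶜ) ^ j := ENNReal.tsum_le_tsum htail
    _ < ⊤ := by
        rw [ENNReal.tsum_geometric, ENNReal.inv_lt_top]
        exact tsub_pos_of_lt (markLaw_longGap_compl_lt_one sys)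

lemma hasFiniteMeanCycle (sys : System M L) {μ : Measure (State M L)}
    (hμ : IsInitialLaw sys μ) : HasFiniteMeanCycle (sampleLaw sys μ) (regenerationEpoch sys) := by
  have := hμ.1
  have hd := measurePreserving_drive sys μ
  have hreg := isRegenerative_delay sys hμ
  have hfm : Measurable fun y : (ℕ → ℕ) × (ℕ → ℝ) => (y.1 1 : ℝ) :=
    measurable_from_nat.comp ((measurable_pi_apply 1).comp measurable_fst)
  have h1 : Integrable (fun y : (ℕ → ℕ) × (ℕ → ℝ) => (y.1 1 : ℝ)) (futureLaw sys) :=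
    (integrable_map_measure hfm.aestronglyMeasurable
      (measurable_freshStart sys).aemeasurable).2 (integrable_epoch_one sys)
  rw [← hreg.map_future 0, future_eq, integrable_map_measure hfm.aestronglyMeasurable
    ((measurable_futureOf sys 0).comp hd.measurable).aemeasurable] at h1
  refine h1.congr ?_
  filter_upwards [hreg.strictMono] with ω hω
  exact Nat.cast_sub (hω.monotone (Nat.zero_le 1))

lemma isAperiodicCycle (sys : System M L) {μ : Measure (State M L)}
    (hμ : IsInitialLaw sys μ) : IsAperiodicCycle (sampleLaw sys μ) (regenerationEpoch sys) := by
  intro d hd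
  by_contra hne
  have := hμ.1
  have hdr := measurePreserving_drive sys μ
  have hset : MeasurableSet {y : (ℕ → ℕ) × (ℕ → ℝ) | y.1 1 = 1} :=
    ((measurable_pi_apply 1).comp measurable_fst) (measurableSet_singleton 1)
  have h0 : futureLaw sys {y | y.1 1 = 1} = 0 := by
    rw [← (isRegenerative_delay sys hμ).map_future 0, future_eq,
      Measure.map_apply ((measurable_futureOf sys 0).comp hdr.measurable) hset]
    have hd0 : sampleLaw sys μ
        {ω | ¬ d ∣ regenerationEpoch sys 1 ω - regenerationEpoch sys 0 ω} = 0 := hd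
    refine measure_mono_null ?_ hd0
    intro ω hω hdvd
    refine hne ?_
    have h1 : regenerationEpoch sys 1 ω - regenerationEpoch sys 0 ω = 1 := hω
    rw [h1] at hdvd
    exact Nat.dvd_one.1 hdvd
  -- two successive long gaps give a cycle of length one
  have h1 : marksLaw sys ((fun V => V 0) ⁻¹' longGap sys) ≤ futureLaw sys {y | y.1 1 = 1} := by
    rw [futureLaw, Measure.map_apply (measurable_freshStart sys) hset]
    refine measure_mono fun V hV => ?_
    refine Nat.nth_of_forall fun i hi => ?_
    interval_cases i
    · trivial
    · exact hV
  rw [h0, marksLaw,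
    (measurePreserving_eval_infinitePi (fun _ : ℕ => markLaw sys) 0).measure_preimage
      (measurableSet_longGap sys).nullMeasurableSet] at h1
  exact markLaw_longGap_ne_zero sys (le_antisymm h1 zero_le)

/-! ### Uniqueness of the stationary law -/

instance (sys : System M L) : IsProbabilityMeasure (stationaryDelayLaw sys) := by
  have := (isInitialLaw_stationary sys).1
  rw [← delayLawFrom_stationaryInitialLaw sys 0]
  exact isProbabilityMeasure_delayLawFrom sys _ 0

lemma IsStationaryLaw.eq_stationaryDelayLaw {sys : System M L} {ν : Measure (ℕ → ℝ)}
    (h : IsStationaryLaw sys ν) : ν = stationaryDelayLaw sys := by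
  obtain ⟨μ, hμ, hν⟩ := h
  have := hμ.1
  have : IsProbabilityMeasure ν := hν 0 ▸ isProbabilityMeasure_delayLawFrom sys μ 0
  refine measure_eq_of_abs_sub_le (tendsto_couplingBound sys) fun k A hA => ?_
  rw [← hν k]
  exact abs_delayLawFrom_sub_stationary_le sys hμ k hA

lemma eq_map_stationaryDelayLaw (sys : System M L) {μ : Measure (State M L)}
    (hμ : IsInitialLaw sys μ) {π : Measure ℝ}
    (hπ : ∀ k, (sampleLaw sys μ).map (delay sys k) = π) :
    π = (stationaryDelayLaw sys).map fun x => x 0 := by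
  have hm : Measurable fun x : ℕ → ℝ => x 0 := measurable_pi_apply 0
  have := hμ.1
  have : IsProbabilityMeasure π := by
    have := isProbabilityMeasure_delayLawFrom sys μ 0
    rw [← hπ 0, ← map_delayLawFrom]
    exact Measure.isProbabilityMeasure_map hm.aemeasurable
  have : IsProbabilityMeasure ((stationaryDelayLaw sys).map fun x => x 0) :=
    Measure.isProbabilityMeasure_map hm.aemeasurable
  refine measure_eq_of_abs_sub_le (tendsto_couplingBound sys) fun k A hA => ?_
  rw [← hπ k]
  exact abs_map_delay_sub_stationary_le sys hμ k hA

end MulticastQueue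

end

theorem proposition1 {M L : ℕ} (sys : MulticastQueue.System M L) :
    -- the delay process is aperiodic regenerative with finite mean regeneration interval
    (∃ (S : ℕ → MulticastQueue.Sample sys → ℕ) (Q : Measure ((ℕ → ℕ) × (ℕ → ℝ))),
      ∀ μ : Measure (MulticastQueue.State M L), MulticastQueue.IsInitialLaw sys μ →
        MulticastQueue.IsRegenerative (MulticastQueue.sampleLaw sys μ)
          (MulticastQueue.delay sys) S Q ∧
        MulticastQueue.HasFiniteMeanCycle (MulticastQueue.sampleLaw sys μ) S ∧
        MulticastQueue.IsAperiodicCycle (MulticastQueue.sampleLaw sys μ) S) ∧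
    -- it has a unique stationary distribution, as a process and for its one-dimensional marginal
    ∃ ν : Measure (ℕ → ℝ),
      MulticastQueue.IsStationaryLaw sys ν ∧
      (∀ ν' : Measure (ℕ → ℝ), MulticastQueue.IsStationaryLaw sys ν' → ν' = ν) ∧
      (∀ (μ : Measure (MulticastQueue.State M L)) (π : Measure ℝ),
        MulticastQueue.IsInitialLaw sys μ →
        (∀ k, (MulticastQueue.sampleLaw sys μ).map (MulticastQueue.delay sys k) = π) →
        π = ν.map (fun x => x 0)) ∧
      -- from any initial distribution there is convergence in total variation
      ∀ μ : Measure (MulticastQueue.State M L), MulticastQueue.IsInitialLaw sys μ →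
        Tendsto (fun k => MulticastQueue.tvDist
          ((MulticastQueue.sampleLaw sys μ).map (MulticastQueue.delay sys k))
          (ν.map (fun x => x 0))) atTop (nhds 0) ∧
        Tendsto (fun k => MulticastQueue.tvDist
          (MulticastQueue.delayLawFrom sys μ k) ν) atTop (nhds 0) := by
  exact ⟨⟨MulticastQueue.regenerationEpoch sys, MulticastQueue.futureLaw sys, fun μ hμ =>
      ⟨MulticastQueue.isRegenerative_delay sys hμ, MulticastQueue.hasFiniteMeanCycle sys hμ,
        MulticastQueue.isAperiodicCycle sys hμ⟩⟩,
    MulticastQueue.stationaryDelayLaw sys, MulticastQueue.isStationaryLaw_stationaryDelayLaw sys,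
    fun ν' hν' => hν'.eq_stationaryDelayLaw,
    fun μ π hμ hπ => MulticastQueue.eq_map_stationaryDelayLaw sys hμ hπ,
    fun μ hμ =>
      have h0 : ∀ k, 0 ≤ 2 * MulticastQueue.couplingBound sys k := fun k =>
        mul_nonneg zero_le_two (MulticastQueue.couplingBound_nonneg sys k)
      ⟨MulticastQueue.tendsto_tvDist h0 (MulticastQueue.tendsto_couplingBound sys)
          fun k A hA => MulticastQueue.abs_map_delay_sub_stationary_le sys hμ k hA,
        MulticastQueue.tendsto_tvDist h0 (MulticastQueue.tendsto_couplingBound sys)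
          fun k A hA => MulticastQueue.abs_delayLawFrom_sub_stationary_le sys hμ k hA⟩⟩
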